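/- **Conventions.** An operator system $S$ is a complex $*$-vector space with cones $M_\nu(S)^+\subset M_\nu(S)_{h}$ ($\nu\in\mathbb N$) satisfying $M_\nu(S)^+\cap -M_\nu(S)^+=\{0\}$ and $X^*M_\mu(S)^+X\subset M_\nu(S)^+$ for all scalar $\mu\times\nu$ matrices $X$, and with an Archimedean matrix order unit $1$. Each $M_\nu(S)$ carries the order norm $\|a\|=\inf\{\lambda>0:\begin{bmatrix}\lambda 1&a\\a^*&\lambda 1\end{bmatrix}\ge 0\}$. A soft inductive system $(S,j)$ of operator systems over a directed set $N$ consists of operator systems $S_n$ ($n\in N$) and unital completely positive (ucp) maps $j_{nm}:S_m\to S_n$, $n>m$, extended by $j_{nn}=\mathrm{id}$ and $j_{nm}=0$ if $n\not\ge m$, such that $\lim_m\limsup_n\|(j_{nl}-j_{nm}j_{ml})a\|=0$ for all $l\in N$, $a\in S_l$. Let $\mathcal N(S)=\prod_n S_n$ be the operator system of uniformly bounded nets $a=(a_n)$ (with coordinatewise matrix cones), $\mathcal C(S,j)\subset\mathcal N(S)$ the operator subsystem of $j$-convergent nets, i.e. those with $\lim_m\limsup_n\|a_n-j_{nm}a_m\|=0$,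 and $\mathcal C_0(S)=\{a\in\mathcal N(S):\|a_n\|\to0\}\subset\mathcal C(S,j)$ the null nets. A kernel in an operator system $T$ is the null space $J$ of a ucp map from $T$ into an operator system. The operator system quotient is $T/J$ with unit $1+J$ and the cones $M_\nu(T/J)^+=\{a+M_\nu(J): \forall\varepsilon>0\ \exists b\in M_\nu(J):\ \varepsilon 1+a+b\ge 0\}$ (it has the corresponding order norms), and the operator space quotient is $T/J$ with the quotient norms of $M_\nu(T)/M_\nu(J)$. The kernel $J$ is completely biproximinal if for all $\nu$ and $a\in M_\nu(T)$: (i) $a+M_\nu(J)\in M_\nu(T/J)^+$ if and only if $a+b\ge0$ for some $b\in M_\nu(J)$; (ii) the distance of $a$ to $M_\nu(J)$ is attained. The limit of $(S,j)$ is the operator system quotient $S_\infty=\mathcal C(S,j)/\mathcal C_0(S)$. **Statement.** Let $(S,j)$ be a soft inductive system of operator systems. 1. $\mathcal C_0(S)$ is a completely biproximinal kernel in both $\mathcal C(S,j)$ and $\mathcal N(S)$, and the operator space and operator system quotients $\mathcal C(S,j)/\mathcal C_0(S)$ (resp. $\mathcal N(S)/\mathcal C_0(S)$) are operator systems and are completely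 isometric, i.e. on all matrix levels the two norms coincide. 2. The induced map $S_\infty\to\mathcal N(S)/\mathcal C_0(S)$ is a unital complete order isomorphism onto the image of $\mathcal C(S,j)$ in $\mathcal N(S)/\mathcal C_0(S)$. If $A_n$ are unital C*-algebras and $\iota_n:S_n\to A_n$ are unital complete order embeddings, then $[a]\mapsto[(\iota_n(a_n))_n]$ is a well-defined unital complete order embedding of $\mathcal N(S)/\mathcal C_0(S)$ into the C*-algebra $\prod_nA_n/\bigoplus_nA_n$ (bounded nets modulo null nets), and its restriction to $S_\infty$ is a unital complete order embedding of $S_\infty$ into $\prod_nA_n/\bigoplus_nA_n$. 3. For all $\nu$, $M_\nu(\mathcal C(S,j))$ consists exactly of the nets $a_n\in M_\nu(S_n)$ which are bounded and satisfy $\lim_m\limsup_n\|a_n-j^{(\nu)}_{nm}a_m\|=0$ in the order norms, where $j_{nm}^{(\nu)}$ is $j_{nm}$ applied entrywise; and $x\in M_\nu(S_\infty)$ is positive if and only if $x$ is the class of such a net with $a_n\in M_\nu(S_n)^+$ for all $n$. -/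

import Mathlib

open Filter Topology
open scoped ENNReal ComplexConjugate

namespace SoftLimits

noncomputable section

set_option linter.unusedSectionVars false

section OperatorSystems

/-- The data of a unit and of matrix cones `M_ν(S)⁺ ⊆ M_ν(S)`, `ν ∈ ℕ`. -/
class MatrixOrder (S : Type*) where
  unit : S
  cone : ∀ ν : ℕ, Set (Matrix (Fin ν) (Fin ν) S)

/-- `X* a X` for a scalar `m × n` matrix `X` and `a ∈ M_m(S)`. -/
def conjBy {S : Type*} [AddCommGroup S] [Module ℂ S] {m n : ℕ}
    (X : Matrix (Fin m) (Fin n) ℂ) (a : Matrix (Fin m) (Fin m) S) : Matrix (Fin n) (Fin n) S :=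
  Matrix.of fun i j => ∑ k, ∑ l, (star (X k i) * X l j) • a k l

/-- `λ 1_ν ∈ M_ν(S)`. -/
def scalarUnit {S : Type*} [AddCommGroup S] [Module ℂ S] [MatrixOrder S] (ν : ℕ) (r : ℝ) :
    Matrix (Fin ν) (Fin ν) S :=
  Matrix.diagonal fun _ => (r : ℂ) • (MatrixOrder.unit : S)

/-- Abstract (Choi--Effros) operator systems: matrix ordered `*`-vector spaces over `ℂ` with an
Archimedean matrix order unit. -/
class IsOperatorSystem (S : Type*) [AddCommGroup S] [Module ℂ S] [StarAddMonoid S]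
    [StarModule ℂ S] [MatrixOrder S] : Prop where
  star_unit : star (MatrixOrder.unit : S) = MatrixOrder.unit
  conjTranspose_eq : ∀ {ν : ℕ} {a : Matrix (Fin ν) (Fin ν) S},
    a ∈ MatrixOrder.cone ν → a.conjTranspose = a
  zero_mem : ∀ ν : ℕ, (0 : Matrix (Fin ν) (Fin ν) S) ∈ MatrixOrder.cone ν
  add_mem : ∀ {ν : ℕ} {a b : Matrix (Fin ν) (Fin ν) S},
    a ∈ MatrixOrder.cone ν → b ∈ MatrixOrder.cone ν → a + b ∈ MatrixOrder.cone ν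
  smul_mem : ∀ {ν : ℕ} {r : ℝ} {a : Matrix (Fin ν) (Fin ν) S}, 0 ≤ r →
    a ∈ MatrixOrder.cone ν → (r : ℂ) • a ∈ MatrixOrder.cone ν
  proper : ∀ {ν : ℕ} {a : Matrix (Fin ν) (Fin ν) S},
    a ∈ MatrixOrder.cone ν → -a ∈ MatrixOrder.cone ν → a = 0
  conjBy_mem : ∀ {m n : ℕ} (X : Matrix (Fin m) (Fin n) ℂ) {a : Matrix (Fin m) (Fin m) S},
    a ∈ MatrixOrder.cone m → conjBy X a ∈ MatrixOrder.cone n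
  order_unit : ∀ {ν : ℕ} {a : Matrix (Fin ν) (Fin ν) S}, a.conjTranspose = a →
    ∃ r : ℝ, 0 < r ∧ scalarUnit ν r + a ∈ MatrixOrder.cone ν
  archimedean : ∀ {ν : ℕ} {a : Matrix (Fin ν) (Fin ν) S},
    (∀ r : ℝ, 0 < r → scalarUnit ν r + a ∈ MatrixOrder.cone ν) → a ∈ MatrixOrder.cone ν

/-- The `2ν × 2ν` matrix `[[r 1_ν, a], [a*, r 1_ν]]`. -/
def normBlock {S : Type*} [AddCommGroup S] [Module ℂ S] [Star S] [MatrixOrder S] {ν : ℕ}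
    (r : ℝ) (a : Matrix (Fin ν) (Fin ν) S) : Matrix (Fin (ν + ν)) (Fin (ν + ν)) S :=
  Matrix.reindex finSumFinEquiv finSumFinEquiv
    (Matrix.fromBlocks (scalarUnit ν r) a a.conjTranspose (scalarUnit ν r))

/-- The order norm on `M_ν(S)`. -/
def matNorm {S : Type*} [AddCommGroup S] [Module ℂ S] [Star S] [MatrixOrder S] {ν : ℕ}
    (a : Matrix (Fin ν) (Fin ν) S) : ℝ :=
  sInf {r : ℝ | 0 < r ∧ normBlock r a ∈ MatrixOrder.cone (ν + ν)}

/-- The order norm on `S = M_1(S)`, i.e. `inf {r > 0 | [[r 1, a], [a*, r 1]] ≥ 0}`. -/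
def ordNorm {S : Type*} [AddCommGroup S] [Module ℂ S] [Star S] [MatrixOrder S] (a : S) : ℝ :=
  matNorm (Matrix.of fun _ _ : Fin 1 => a)

/-- Unital completely positive maps. -/
structure IsUCP {S T : Type*} [AddCommGroup S] [Module ℂ S] [MatrixOrder S]
    [AddCommGroup T] [Module ℂ T] [MatrixOrder T] (φ : S →ₗ[ℂ] T) : Prop where
  map_unit : φ MatrixOrder.unit = MatrixOrder.unit
  map_cone : ∀ (ν : ℕ) (a : Matrix (Fin ν) (Fin ν) S),
    a ∈ MatrixOrder.cone ν → a.map φ ∈ MatrixOrder.cone ν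

/-- Unital complete order embeddings, i.e. unital complete order isomorphisms onto the range. -/
structure IsCompleteOrderEmbedding {S T : Type*} [AddCommGroup S] [Module ℂ S] [Star S]
    [MatrixOrder S] [AddCommGroup T] [Module ℂ T] [Star T] [MatrixOrder T]
    (φ : S →ₗ[ℂ] T) : Prop where
  injective : Function.Injective φ
  map_unit : φ MatrixOrder.unit = MatrixOrder.unit
  map_star : ∀ a, φ (star a) = star (φ a)
  mem_cone_iff : ∀ (ν : ℕ) (a : Matrix (Fin ν) (Fin ν) S),
    a ∈ MatrixOrder.cone ν ↔ a.map φ ∈ MatrixOrder.cone ν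

end OperatorSystems

section BasicFacts

theorem block_ext {α : Type*} {m n : ℕ} {M M' : Matrix (Fin (m + n)) (Fin (m + n)) α}
    (h₁ : ∀ i j, M (Fin.castAdd n i) (Fin.castAdd n j) = M' (Fin.castAdd n i) (Fin.castAdd n j))
    (h₂ : ∀ i j, M (Fin.castAdd n i) (Fin.natAdd m j) = M' (Fin.castAdd n i) (Fin.natAdd m j))
    (h₃ : ∀ i j, M (Fin.natAdd m i) (Fin.castAdd n j) = M' (Fin.natAdd m i) (Fin.castAdd n j))
    (h₄ : ∀ i j, M (Fin.natAdd m i) (Fin.natAdd m j) = M' (Fin.natAdd m i) (Fin.natAdd m j)) :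
    M = M' := by
  ext i j
  refine Fin.addCases (fun i => ?_) (fun i => ?_) i <;>
  refine Fin.addCases (fun j => ?_) (fun j => ?_) j
  exacts [h₁ i j, h₂ i j, h₃ i j, h₄ i j]

variable {S : Type*} [AddCommGroup S] [Module ℂ S] [StarAddMonoid S] [StarModule ℂ S]
  [MatrixOrder S] {ν : ℕ}

@[simp] theorem normBlock_ll (r : ℝ) (a : Matrix (Fin ν) (Fin ν) S) (i j : Fin ν) :
    normBlock r a (Fin.castAdd ν i) (Fin.castAdd ν j) = scalarUnit ν r i j := by
  simp [normBlock]

@[simp] theorem normBlock_lr (r : ℝ) (a : Matrix (Fin ν) (Fin ν) S) (i j : Fin ν) :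
    normBlock r a (Fin.castAdd ν i) (Fin.natAdd ν j) = a i j := by
  simp [normBlock, -Fin.natAdd_eq_addNat]

@[simp] theorem normBlock_rl (r : ℝ) (a : Matrix (Fin ν) (Fin ν) S) (i j : Fin ν) :
    normBlock r a (Fin.natAdd ν i) (Fin.castAdd ν j) = star (a j i) := by
  simp [normBlock, -Fin.natAdd_eq_addNat]

@[simp] theorem normBlock_rr (r : ℝ) (a : Matrix (Fin ν) (Fin ν) S) (i j : Fin ν) :
    normBlock r a (Fin.natAdd ν i) (Fin.natAdd ν j) = scalarUnit ν r i j := by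
  simp [normBlock, -Fin.natAdd_eq_addNat]

theorem scalarUnit_add (r s : ℝ) :
    (scalarUnit ν (r + s) : Matrix (Fin ν) (Fin ν) S) = scalarUnit ν r + scalarUnit ν s := by
  simp [scalarUnit, add_smul]

theorem scalarUnit_smul (r s : ℝ) :
    (r : ℂ) • (scalarUnit ν s : Matrix (Fin ν) (Fin ν) S) = scalarUnit ν (r * s) := by
  ext i j
  by_cases h : i = j <;> simp [scalarUnit, h, mul_smul]

theorem normBlock_add (r s : ℝ) (a b : Matrix (Fin ν) (Fin ν) S) :
    normBlock (r + s) (a + b) = normBlock r a + normBlock s b := by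
  refine block_ext (fun i j => ?_) (fun i j => ?_) (fun i j => ?_) (fun i j => ?_) <;>
  simp [-Fin.natAdd_eq_addNat, scalarUnit_add]

theorem normBlock_eq (r : ℝ) (a : Matrix (Fin ν) (Fin ν) S) :
    normBlock r a = scalarUnit (ν + ν) r + normBlock 0 a := by
  refine block_ext (fun i j => ?_) (fun i j => ?_) (fun i j => ?_) (fun i j => ?_) <;>
  simp [-Fin.natAdd_eq_addNat, scalarUnit, Matrix.diagonal_apply, Fin.ext_iff]
  all_goals intros; omega

theorem normBlock_zero_conjTranspose (a : Matrix (Fin ν) (Fin ν) S) :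
    (normBlock 0 a).conjTranspose = normBlock 0 a := by
  refine block_ext (fun i j => ?_) (fun i j => ?_) (fun i j => ?_) (fun i j => ?_) <;>
  simp [-Fin.natAdd_eq_addNat, scalarUnit]

variable [IsOperatorSystem S]

open IsOperatorSystem

theorem scalarUnit_mem (ν : ℕ) {r : ℝ} (hr : 0 ≤ r) :
    (scalarUnit ν r : Matrix (Fin ν) (Fin ν) S) ∈ MatrixOrder.cone ν := by
  obtain ⟨s, hs, h⟩ := order_unit (S := S) (ν := ν) (a := 0) (by simp)
  rw [add_zero] at h
  have := smul_mem (r := r / s) (by positivity) h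
  rwa [scalarUnit_smul, div_mul_cancel₀ _ hs.ne'] at this

theorem normBlock_mono {r s : ℝ} (hrs : r ≤ s) {a : Matrix (Fin ν) (Fin ν) S}
    (h : normBlock r a ∈ MatrixOrder.cone (ν + ν)) :
    normBlock s a ∈ MatrixOrder.cone (ν + ν) := by
  rw [normBlock_eq] at h ⊢
  have := add_mem (scalarUnit_mem (S := S) (ν + ν) (sub_nonneg.2 hrs)) h
  rwa [← add_assoc, ← scalarUnit_add, sub_add_cancel] at this

theorem matNorm_nonneg (a : Matrix (Fin ν) (Fin ν) S) : 0 ≤ matNorm a :=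
  Real.sInf_nonneg fun _ h => h.1.le

theorem exists_normBlock_mem (a : Matrix (Fin ν) (Fin ν) S) :
    ∃ r : ℝ, 0 < r ∧ normBlock r a ∈ MatrixOrder.cone (ν + ν) := by
  obtain ⟨r, hr, h⟩ := order_unit (normBlock_zero_conjTranspose a)
  exact ⟨r, hr, by rwa [normBlock_eq]⟩

theorem normBlock_mem_of_matNorm_lt {a : Matrix (Fin ν) (Fin ν) S} {r : ℝ}
    (h : matNorm a < r) : normBlock r a ∈ MatrixOrder.cone (ν + ν) := by
  obtain ⟨s, hs, hsr⟩ := exists_lt_of_csInf_lt (exists_normBlock_mem a) h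
  exact normBlock_mono hsr.le hs.2

theorem matNorm_le {a : Matrix (Fin ν) (Fin ν) S} {r : ℝ} (hr : 0 ≤ r)
    (h : normBlock r a ∈ MatrixOrder.cone (ν + ν)) : matNorm a ≤ r := by
  refine le_of_forall_pos_le_add fun ε hε => csInf_le ⟨0, fun _ h => h.1.le⟩ ?_
  exact ⟨by positivity, normBlock_mono (by linarith) h⟩

/-- The infimum defining the order norm is attained, up to the requirement `r > 0`. -/
theorem normBlock_matNorm_mem (a : Matrix (Fin ν) (Fin ν) S) :
    normBlock (matNorm a) a ∈ MatrixOrder.cone (ν + ν) := by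
  refine archimedean fun r hr => ?_
  rw [normBlock_eq, ← add_assoc, ← scalarUnit_add, ← normBlock_eq]
  exact normBlock_mem_of_matNorm_lt (by linarith)

theorem matNorm_add_le (a b : Matrix (Fin ν) (Fin ν) S) :
    matNorm (a + b) ≤ matNorm a + matNorm b :=
  matNorm_le (add_nonneg (matNorm_nonneg a) (matNorm_nonneg b)) <| by
    rw [normBlock_add]
    exact add_mem (normBlock_matNorm_mem a) (normBlock_matNorm_mem b)

theorem conjBy_submatrix {m n : ℕ} (f : Fin n → Fin m) (c : Fin n → ℂ)
    (a : Matrix (Fin m) (Fin m) S) :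
    conjBy (Matrix.of fun k i => if k = f i then c i else 0) a =
      Matrix.of fun i j => (star (c i) * c j) • a (f i) (f j) := by
  ext i j
  simp only [conjBy, Matrix.of_apply]
  rw [Finset.sum_eq_single (f i), Finset.sum_eq_single (f j)]
  · simp
  · intro l _ hl; simp [hl]
  · simp
  · intro k _ hk; simp [hk]
  · simp

theorem matNorm_smul_le_of_norm_one {c : ℂ} (hc : ‖c‖ = 1) (a : Matrix (Fin ν) (Fin ν) S) :
    matNorm (c • a) ≤ matNorm a := by
  refine matNorm_le (matNorm_nonneg a) ?_
  have h := conjBy_mem (Matrix.of fun k i => if k = id i then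
    (Fin.addCases (fun _ => 1) (fun _ => c) i : ℂ) else 0) (normBlock_matNorm_mem a)
  rw [conjBy_submatrix] at h
  have hcc : (starRingEnd ℂ) c * c = 1 := by
    rw [mul_comm, Complex.mul_conj, Complex.normSq_eq_norm_sq, hc]; simp
  convert h using 1
  refine block_ext (fun i j => ?_) (fun i j => ?_) (fun i j => ?_) (fun i j => ?_) <;>
  simp [-Fin.natAdd_eq_addNat, hcc]

theorem matNorm_smul_le_of_nonneg {r : ℝ} (hr : 0 ≤ r) (a : Matrix (Fin ν) (Fin ν) S) :
    matNorm ((r : ℂ) • a) ≤ r * matNorm a := by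
  refine matNorm_le (mul_nonneg hr (matNorm_nonneg a)) ?_
  have h := smul_mem hr (normBlock_matNorm_mem a)
  convert h using 1
  refine block_ext (fun i j => ?_) (fun i j => ?_) (fun i j => ?_) (fun i j => ?_) <;>
  simp [-Fin.natAdd_eq_addNat, ← scalarUnit_smul]

theorem matNorm_smul_le (c : ℂ) (a : Matrix (Fin ν) (Fin ν) S) :
    matNorm (c • a) ≤ ‖c‖ * matNorm a := by
  by_cases hc : c = 0
  · subst hc
    simpa using matNorm_smul_le_of_nonneg le_rfl a
  · have h : c • a = ((‖c‖ : ℝ) : ℂ) • ((c / (‖c‖ : ℂ)) • a) := by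
      rw [smul_smul, mul_div_cancel₀]
      simpa using hc
    rw [h]
    refine (matNorm_smul_le_of_nonneg (norm_nonneg c) _).trans ?_
    refine mul_le_mul_of_nonneg_left (matNorm_smul_le_of_norm_one ?_ a) (norm_nonneg c)
    simp [hc]

theorem matNorm_conjTranspose_le (a : Matrix (Fin ν) (Fin ν) S) :
    matNorm a.conjTranspose ≤ matNorm a := by
  refine matNorm_le (matNorm_nonneg a) ?_
  have h := conjBy_mem (Matrix.of fun k i => if k =
    (Fin.addCases (fun i => Fin.natAdd ν i) (fun i => Fin.castAdd ν i) i : Fin (ν + ν)) then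
    (1 : ℂ) else 0) (normBlock_matNorm_mem a)
  rw [conjBy_submatrix _ (fun _ => (1 : ℂ))] at h
  convert h using 1
  refine block_ext (fun i j => ?_) (fun i j => ?_) (fun i j => ?_) (fun i j => ?_) <;>
  simp [-Fin.natAdd_eq_addNat]

theorem ordNorm_nonneg (a : S) : 0 ≤ ordNorm a := matNorm_nonneg _

theorem ordNorm_add_le (a b : S) : ordNorm (a + b) ≤ ordNorm a + ordNorm b :=
  matNorm_add_le (Matrix.of fun _ _ : Fin 1 => a) (Matrix.of fun _ _ : Fin 1 => b)

theorem ordNorm_smul_le (c : ℂ) (a : S) : ordNorm (c • a) ≤ ‖c‖ * ordNorm a :=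
  matNorm_smul_le c (Matrix.of fun _ _ : Fin 1 => a)

theorem ordNorm_neg_le (a : S) : ordNorm (-a) ≤ ordNorm a := by
  simpa using ordNorm_smul_le (-1) a

theorem ordNorm_sub_le (a b : S) : ordNorm (a - b) ≤ ordNorm a + ordNorm b := by
  rw [sub_eq_add_neg]
  exact (ordNorm_add_le a (-b)).trans (add_le_add_right (ordNorm_neg_le b) _)

theorem ordNorm_star_le (a : S) : ordNorm (star a) ≤ ordNorm a :=
  matNorm_conjTranspose_le (Matrix.of fun _ _ : Fin 1 => a)

theorem ordNorm_zero : ordNorm (0 : S) = 0 :=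
  le_antisymm (by simpa using ordNorm_smul_le 0 (0 : S)) (ordNorm_nonneg _)

theorem ordNorm_unit_le : ordNorm (MatrixOrder.unit : S) ≤ 1 := by
  refine matNorm_le zero_le_one ?_
  have h := conjBy_mem (Matrix.of fun (k : Fin 1) (i : Fin (1 + 1)) => if k = 0 then
    (1 : ℂ) else 0) (scalarUnit_mem (S := S) 1 zero_le_one)
  rw [conjBy_submatrix (fun _ => 0) (fun _ => (1 : ℂ))] at h
  convert h using 1
  refine block_ext (fun i j => ?_) (fun i j => ?_) (fun i j => ?_) (fun i j => ?_) <;>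
  simp [-Fin.natAdd_eq_addNat, scalarUnit, star_unit, Subsingleton.elim i j]

variable {T : Type*} [AddCommGroup T] [Module ℂ T] [StarAddMonoid T] [StarModule ℂ T]
  [MatrixOrder T] [IsOperatorSystem T]

theorem IsUCP.map_star {φ : S →ₗ[ℂ] T} (hφ : IsUCP φ) (a : S) : φ (star a) = star (φ a) := by
  have h1 := hφ.map_cone _ _ (normBlock_matNorm_mem (Matrix.of fun _ _ : Fin 1 => a))
  have h2 := congrFun (congrFun (conjTranspose_eq h1) (Fin.natAdd 1 0)) (Fin.castAdd 1 0)
  simp [-Fin.natAdd_eq_addNat, -Fin.natAdd_zero, -Fin.castAdd_zero] at h2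
  exact h2.symm

theorem IsUCP.ordNorm_le {φ : S →ₗ[ℂ] T} (hφ : IsUCP φ) (a : S) :
    ordNorm (φ a) ≤ ordNorm a := by
  refine matNorm_le (ordNorm_nonneg a) ?_
  have h := hφ.map_cone _ _ (normBlock_matNorm_mem (Matrix.of fun _ _ : Fin 1 => a))
  convert h using 1
  refine block_ext (fun i j => ?_) (fun i j => ?_) (fun i j => ?_) (fun i j => ?_) <;>
  simp [-Fin.natAdd_eq_addNat, scalarUnit, hφ.map_unit, hφ.map_star, ordNorm, Subsingleton.elim i j]

theorem sum_mem_cone {ι : Type*} (t : Finset ι) (f : ι → Matrix (Fin ν) (Fin ν) S)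
    (h : ∀ i ∈ t, f i ∈ MatrixOrder.cone ν) : ∑ i ∈ t, f i ∈ MatrixOrder.cone ν := by
  classical
  induction t using Finset.induction_on with
  | empty => simpa using zero_mem (S := S) ν
  | insert i t hi ih =>
    rw [Finset.sum_insert hi]
    exact add_mem (h i (Finset.mem_insert_self i t))
      (ih fun j hj => h j (Finset.mem_insert_of_mem hj))

/-- A hermitian matrix is bounded below in terms of the order norms of its entries. -/
theorem scalarUnit_add_mem_of_entries {a : Matrix (Fin ν) (Fin ν) S} (ha : a.conjTranspose = a)
    {C : ℝ} (h : ∀ i j, ordNorm (a i j) ≤ C) :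
    scalarUnit ν (ν * C) + a ∈ MatrixOrder.cone ν := by
  let b : Fin ν → Fin ν → Matrix (Fin (1 + 1)) (Fin (1 + 1)) S := fun i j =>
    normBlock C (Matrix.of fun _ _ : Fin 1 => a i j)
  let X : Fin ν → Fin ν → Matrix (Fin (1 + 1)) (Fin ν) ℂ := fun i j =>
    Matrix.of fun k p => Fin.addCases (fun _ => if p = i then 1 else 0)
      (fun _ => if p = j then 1 else 0) k
  have hb : ∀ i j, conjBy (X i j) (b i j) ∈ MatrixOrder.cone ν := fun i j =>
    conjBy_mem _ (normBlock_mono (h i j) (normBlock_matNorm_mem _))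
  have hsum := smul_mem (r := 1 / 2) (by norm_num) (sum_mem_cone Finset.univ
    (fun i => ∑ j, conjBy (X i j) (b i j)) fun i _ => sum_mem_cone _ _ fun j _ => hb i j)
  convert hsum using 1
  have haa : ∀ p q, star (a q p) = a p q := fun p q => congrFun (congrFun ha p) q
  ext p q
  simp only [conjBy, b, X, Fin.sum_univ_add, Matrix.of_apply, Fin.addCases_left,
    Fin.addCases_right, normBlock_ll, normBlock_lr, normBlock_rl, normBlock_rr,
    Matrix.add_apply, Matrix.smul_apply, Matrix.sum_apply, Finset.univ_unique,
    Finset.sum_singleton, scalarUnit, Matrix.diagonal_apply, Finset.sum_add_distrib]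
  by_cases hpq : p = q
  · subst hpq
    simp [ite_smul, haa, Finset.sum_ite_eq]
    rw [← Complex.coe_smul C, ← Nat.cast_smul_eq_nsmul ℂ]
    module
  · simp [ite_smul, haa, hpq, Finset.sum_ite_eq]
    module

end BasicFacts
section SubspacesAndQuotients

variable {T : Type*} [AddCommGroup T] [Module ℂ T] [StarAddMonoid T] [StarModule ℂ T]
  [MatrixOrder T]

/-- Self-adjoint linear subspaces. -/
structure SelfAdjointSubspace (T : Type*) [AddCommGroup T] [Module ℂ T] [StarAddMonoid T] extends
    Submodule ℂ T where
  star_mem' : ∀ {a : T}, a ∈ carrier → star a ∈ carrier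

/-- Unital self-adjoint linear subspaces. -/
structure UnitalSubspace (T : Type*) [AddCommGroup T] [Module ℂ T] [StarAddMonoid T]
    [MatrixOrder T] extends SelfAdjointSubspace T where
  unit_mem' : (MatrixOrder.unit : T) ∈ carrier

/-- A unital self-adjoint subspace as a type. -/
def UnitalSubspace.Elem (V : UnitalSubspace T) : Type _ := V.toSubmodule

instance (V : UnitalSubspace T) : AddCommGroup V.Elem :=
  inferInstanceAs (AddCommGroup V.toSubmodule)

instance (V : UnitalSubspace T) : Module ℂ V.Elem :=
  inferInstanceAs (Module ℂ V.toSubmodule)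

/-- The inclusion map. -/
def UnitalSubspace.incl (V : UnitalSubspace T) : V.Elem →ₗ[ℂ] T := V.toSubmodule.subtype

theorem UnitalSubspace.incl_injective (V : UnitalSubspace T) : Function.Injective V.incl :=
  Subtype.val_injective

instance (V : UnitalSubspace T) : StarAddMonoid V.Elem where
  star a := ⟨star (V.incl a), V.star_mem' a.2⟩
  star_involutive a := V.incl_injective (star_star (V.incl a))
  star_add a b := V.incl_injective (star_add (V.incl a) (V.incl b))

theorem UnitalSubspace.incl_star (V : UnitalSubspace T) (a : V.Elem) :
    V.incl (star a) = star (V.incl a) := rfl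

instance (V : UnitalSubspace T) : StarModule ℂ V.Elem where
  star_smul c a := V.incl_injective (star_smul c (V.incl a))

/-- A unital self-adjoint subspace carries the inherited unit and matrix cones. -/
instance (V : UnitalSubspace T) : MatrixOrder V.Elem where
  unit := ⟨MatrixOrder.unit, V.unit_mem'⟩
  cone ν := {a | a.map V.incl ∈ MatrixOrder.cone ν}

theorem UnitalSubspace.incl_unit (V : UnitalSubspace T) :
    V.incl MatrixOrder.unit = MatrixOrder.unit := rfl

theorem UnitalSubspace.map_scalarUnit (V : UnitalSubspace T) (ν : ℕ) (r : ℝ) :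
    (scalarUnit ν r : Matrix (Fin ν) (Fin ν) V.Elem).map V.incl = scalarUnit ν r := by
  ext i j
  by_cases h : i = j <;> simp [scalarUnit, h, V.incl_unit]

theorem UnitalSubspace.map_add (V : UnitalSubspace T) {ν : ℕ}
    (a b : Matrix (Fin ν) (Fin ν) V.Elem) :
    (a + b).map V.incl = a.map V.incl + b.map V.incl := rfl

theorem UnitalSubspace.map_conjBy (V : UnitalSubspace T) {m n : ℕ}
    (X : Matrix (Fin m) (Fin n) ℂ) (a : Matrix (Fin m) (Fin m) V.Elem) :
    (conjBy X a).map V.incl = conjBy X (a.map V.incl) := by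
  ext i j
  simp [conjBy]

theorem UnitalSubspace.map_conjTranspose (V : UnitalSubspace T) {ν : ℕ}
    (a : Matrix (Fin ν) (Fin ν) V.Elem) :
    a.conjTranspose.map V.incl = (a.map V.incl).conjTranspose := rfl

theorem UnitalSubspace.map_inj (V : UnitalSubspace T) {ν : ℕ}
    {a b : Matrix (Fin ν) (Fin ν) V.Elem} (h : a.map V.incl = b.map V.incl) : a = b := by
  ext i j
  exact V.incl_injective (congrFun (congrFun h i) j)

/-- A unital self-adjoint subspace of an operator system is an operator system. -/
instance [IsOperatorSystem T] (V : UnitalSubspace T) : IsOperatorSystem V.Elem where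
  star_unit := V.incl_injective IsOperatorSystem.star_unit
  conjTranspose_eq ha := V.map_inj (IsOperatorSystem.conjTranspose_eq (S := T) ha)
  zero_mem ν := IsOperatorSystem.zero_mem (S := T) ν
  add_mem ha hb := IsOperatorSystem.add_mem (S := T) ha hb
  smul_mem hr ha := IsOperatorSystem.smul_mem (S := T) hr ha
  proper ha hb := V.map_inj (IsOperatorSystem.proper (S := T) ha hb)
  conjBy_mem X a ha := by
    have := IsOperatorSystem.conjBy_mem (S := T) X ha
    rwa [← V.map_conjBy] at this
  order_unit {ν a} ha := by
    obtain ⟨r, hr, h⟩ := IsOperatorSystem.order_unit (S := T)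
      (a := a.map V.incl) (by rw [← V.map_conjTranspose, ha])
    rw [← V.map_scalarUnit, ← V.map_add] at h
    exact ⟨r, hr, h⟩
  archimedean {ν a} h := by
    refine IsOperatorSystem.archimedean (S := T) (a := a.map V.incl) fun r hr => ?_
    rw [← V.map_scalarUnit, ← V.map_add]
    exact h r hr

/-- The subspace `J ∩ V` of `V`. -/
def SelfAdjointSubspace.restrict (J : SelfAdjointSubspace T) (V : UnitalSubspace T) :
    SelfAdjointSubspace V.Elem where
  toSubmodule := J.toSubmodule.comap V.incl
  star_mem' ha := J.star_mem' ha

/-- The quotient `T/J` by a self-adjoint subspace. -/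
def SelfAdjointSubspace.Quotient (J : SelfAdjointSubspace T) : Type _ := T ⧸ J.toSubmodule

instance (J : SelfAdjointSubspace T) : AddCommGroup J.Quotient :=
  inferInstanceAs (AddCommGroup (T ⧸ J.toSubmodule))

instance (J : SelfAdjointSubspace T) : Module ℂ J.Quotient :=
  inferInstanceAs (Module ℂ (T ⧸ J.toSubmodule))

/-- The quotient map `T → T/J`. -/
def SelfAdjointSubspace.quotMap (J : SelfAdjointSubspace T) : T →ₗ[ℂ] J.Quotient :=
  J.toSubmodule.mkQ

instance (J : SelfAdjointSubspace T) : StarAddMonoid J.Quotient where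
  star := Quotient.map' star fun a b h => by
    rw [Submodule.quotientRel_def] at h ⊢
    rw [← star_sub]
    exact J.star_mem' h
  star_involutive := by
    rintro ⟨a⟩
    exact congrArg J.quotMap (star_star a)
  star_add := by
    rintro ⟨a⟩ ⟨b⟩
    exact congrArg J.quotMap (star_add a b)

instance (J : SelfAdjointSubspace T) : StarModule ℂ J.Quotient where
  star_smul := by
    rintro c ⟨a⟩
    exact congrArg J.quotMap (star_smul c a)

/-- The unit and the matrix cones of the operator system quotient `T/J`:
`M_ν(T/J)⁺` consists of the classes of those `a ∈ M_ν(T)` such that for each `ε > 0` there is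
`b ∈ M_ν(J)` with `ε 1 + a + b ≥ 0`. -/
instance (J : SelfAdjointSubspace T) : MatrixOrder J.Quotient where
  unit := J.quotMap MatrixOrder.unit
  cone ν := {x | ∃ a : Matrix (Fin ν) (Fin ν) T, a.map J.quotMap = x ∧
    ∀ ε : ℝ, 0 < ε → ∃ b : Matrix (Fin ν) (Fin ν) T, (∀ i j, b i j ∈ J.toSubmodule) ∧
      scalarUnit ν ε + a + b ∈ MatrixOrder.cone ν}

/-- The norm on `M_ν(T/J)` of the operator space quotient: the quotient norm of
`M_ν(T)/M_ν(J)`. -/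
def opSpaceQuotNorm (J : SelfAdjointSubspace T) {ν : ℕ}
    (x : Matrix (Fin ν) (Fin ν) J.Quotient) : ℝ :=
  sInf {r : ℝ | ∃ a : Matrix (Fin ν) (Fin ν) T, a.map J.quotMap = x ∧ matNorm a = r}

/-- The identity map between the operator space quotient `T/J` and the operator system quotient
`T/J` is a complete isometry. -/
def QuotientsCompletelyIsometric (J : SelfAdjointSubspace T) : Prop :=
  ∀ (ν : ℕ) (x : Matrix (Fin ν) (Fin ν) J.Quotient), opSpaceQuotNorm J x = matNorm x

end SubspacesAndQuotients

section Kernels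

/-- A kernel in an operator system: the null space of a ucp map into an operator system. -/
def IsKernel.{u} {T : Type u} [AddCommGroup T] [Module ℂ T] [StarAddMonoid T]
    [MatrixOrder T] (J : SelfAdjointSubspace T) : Prop :=
  ∃ (R : Type u) (_ : AddCommGroup R) (_ : Module ℂ R) (_ : StarAddMonoid R)
    (_ : StarModule ℂ R) (_ : MatrixOrder R) (_ : IsOperatorSystem R) (φ : T →ₗ[ℂ] R),
    IsUCP φ ∧ LinearMap.ker φ = J.toSubmodule

variable {T : Type*} [AddCommGroup T] [Module ℂ T] [StarAddMonoid T] [StarModule ℂ T]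
  [MatrixOrder T]

/-- `a + J ≥ 0` in `M_ν(T/J)` if and only if `a + b ≥ 0` for some `b ∈ M_ν(J)`, for all `ν`. -/
def IsCompletelyOrderProximinal (J : SelfAdjointSubspace T) : Prop :=
  ∀ (ν : ℕ) (a : Matrix (Fin ν) (Fin ν) T),
    a.map J.quotMap ∈ MatrixOrder.cone ν ↔
      ∃ b : Matrix (Fin ν) (Fin ν) T, (∀ i j, b i j ∈ J.toSubmodule) ∧
        a + b ∈ MatrixOrder.cone ν

/-- The distance of `a ∈ M_ν(T)` to `M_ν(J)` is attained, for all `ν`. -/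
def IsCompletelyNormProximinal (J : SelfAdjointSubspace T) : Prop :=
  ∀ (ν : ℕ) (a : Matrix (Fin ν) (Fin ν) T),
    ∃ b : Matrix (Fin ν) (Fin ν) T, (∀ i j, b i j ∈ J.toSubmodule) ∧
      matNorm (a + b) = opSpaceQuotNorm J (a.map J.quotMap)

/-- Completely biproximinal kernels: kernels which are proximinal both with respect to the order
and with respect to the norm, on all matrix levels. -/
structure IsCompletelyBiproximinalKernel (J : SelfAdjointSubspace T) : Prop where
  isKernel : IsKernel J
  orderProximinal : IsCompletelyOrderProximinal J
  normProximinal : IsCompletelyNormProximinal J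

end Kernels

section Nets

variable {N : Type*} {S : N → Type*} [∀ n, AddCommGroup (S n)] [∀ n, Module ℂ (S n)]
  [∀ n, StarAddMonoid (S n)] [∀ n, StarModule ℂ (S n)] [∀ n, MatrixOrder (S n)]

/-- Families of elements: coordinatewise unit and coordinatewise matrix cones. -/
instance : MatrixOrder (∀ n, S n) where
  unit := fun _ => MatrixOrder.unit
  cone ν := {a | ∀ n, (a.map fun x => x n) ∈ MatrixOrder.cone ν}

variable [∀ n, IsOperatorSystem (S n)]

/-- The direct product `∏_n S_n` of operator systems: the uniformly bounded nets. -/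
def nets (S : N → Type*) [∀ n, AddCommGroup (S n)] [∀ n, Module ℂ (S n)]
    [∀ n, StarAddMonoid (S n)] [∀ n, StarModule ℂ (S n)] [∀ n, MatrixOrder (S n)]
    [∀ n, IsOperatorSystem (S n)] : UnitalSubspace (∀ n, S n) where
  carrier := {a | ∃ C : ℝ, ∀ n, ordNorm (a n) ≤ C}
  zero_mem' := ⟨0, fun _ => ordNorm_zero.le⟩
  add_mem' := by
    rintro a b ⟨C, hC⟩ ⟨D, hD⟩
    exact ⟨C + D, fun n => (ordNorm_add_le _ _).trans (add_le_add (hC n) (hD n))⟩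
  smul_mem' := by
    rintro c a ⟨C, hC⟩
    exact ⟨‖c‖ * C, fun n => (ordNorm_smul_le _ _).trans
      (mul_le_mul_of_nonneg_left (hC n) (norm_nonneg c))⟩
  star_mem' := by
    rintro a ⟨C, hC⟩
    exact ⟨C, fun n => (ordNorm_star_le _).trans (hC n)⟩
  unit_mem' := ⟨1, fun _ => ordNorm_unit_le⟩

/-- The type of uniformly bounded nets. -/
abbrev Nets (S : N → Type*) [∀ n, AddCommGroup (S n)] [∀ n, Module ℂ (S n)]
    [∀ n, StarAddMonoid (S n)] [∀ n, StarModule ℂ (S n)] [∀ n, MatrixOrder (S n)]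
    [∀ n, IsOperatorSystem (S n)] : Type _ := (nets S).Elem

/-- The `n`-th entry of a net. -/
def Nets.eval (n : N) : Nets S →ₗ[ℂ] S n := LinearMap.proj n ∘ₗ (nets S).incl

theorem Nets.eval_unit (n : N) : Nets.eval n (MatrixOrder.unit : Nets S) = MatrixOrder.unit := rfl

theorem Nets.mem_cone_iff {ν : ℕ} (a : Matrix (Fin ν) (Fin ν) (Nets S)) :
    a ∈ MatrixOrder.cone ν ↔ ∀ n, (a.map (Nets.eval n)) ∈ MatrixOrder.cone ν := Iff.rfl

theorem Nets.map_scalarUnit (ν : ℕ) (r : ℝ) (n : N) :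
    (scalarUnit ν r : Matrix (Fin ν) (Fin ν) (Nets S)).map (Nets.eval n) =
      scalarUnit ν r := by
  ext i j
  by_cases h : i = j <;> simp [scalarUnit, h, Nets.eval_unit]

theorem Nets.map_conjBy {m k : ℕ} (X : Matrix (Fin m) (Fin k) ℂ)
    (a : Matrix (Fin m) (Fin m) (Nets S)) (n : N) :
    (conjBy X a).map (Nets.eval n) = conjBy X (a.map (Nets.eval n)) := by
  ext i j
  simp [conjBy]

theorem Nets.map_inj {ν : ℕ} {a b : Matrix (Fin ν) (Fin ν) (Nets S)}
    (h : ∀ n, a.map (Nets.eval n) = b.map (Nets.eval n)) : a = b := by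
  ext i j
  exact (nets S).incl_injective (funext fun n => congrFun (congrFun (h n) i) j)

/-- The direct product of operator systems is an operator system. -/
instance : IsOperatorSystem (Nets S) where
  star_unit := (nets S).incl_injective (funext fun _ => IsOperatorSystem.star_unit)
  conjTranspose_eq ha := Nets.map_inj fun n => IsOperatorSystem.conjTranspose_eq (ha n)
  zero_mem ν n := IsOperatorSystem.zero_mem ν
  add_mem ha hb n := IsOperatorSystem.add_mem (ha n) (hb n)
  smul_mem hr ha n := IsOperatorSystem.smul_mem hr (ha n)
  proper ha hb := Nets.map_inj fun n => IsOperatorSystem.proper (ha n) (hb n)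
  conjBy_mem X a ha := by
    rw [Nets.mem_cone_iff]
    intro n
    rw [Nets.map_conjBy]
    exact IsOperatorSystem.conjBy_mem X (ha n)
  order_unit {ν a} ha := by
    choose C hC using fun i j => (a i j).2
    obtain ⟨D, hD⟩ := (Set.finite_range fun p : Fin ν × Fin ν => C p.1 p.2).bddAbove
    refine ⟨ν * |D| + 1, by positivity, ?_⟩
    rw [Nets.mem_cone_iff]
    intro n
    have h1 := scalarUnit_add_mem_of_entries (a := a.map (Nets.eval n)) (C := |D|)
      (by ext i j; exact congrArg (Nets.eval n) (congrFun (congrFun ha i) j))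
      fun i j => (hC i j n).trans ((hD ⟨(i, j), rfl⟩).trans (le_abs_self D))
    have h2 := IsOperatorSystem.add_mem (scalarUnit_mem (S := S n) ν zero_le_one) h1
    rw [← add_assoc, ← scalarUnit_add, add_comm 1, ← Nets.map_scalarUnit] at h2
    exact h2
  archimedean {ν a} h := by
    rw [Nets.mem_cone_iff]
    refine fun n => IsOperatorSystem.archimedean fun r hr => ?_
    rw [← Nets.map_scalarUnit]
    exact h r hr n

variable [Preorder N] [IsDirectedOrder N] [Nonempty N]

/-- The null nets `C_0`. -/
def nullNets (S : N → Type*) [∀ n, AddCommGroup (S n)] [∀ n, Module ℂ (S n)]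
    [∀ n, StarAddMonoid (S n)] [∀ n, StarModule ℂ (S n)] [∀ n, MatrixOrder (S n)]
    [∀ n, IsOperatorSystem (S n)] : SelfAdjointSubspace (Nets S) where
  carrier := {a | Tendsto (fun n => ordNorm (Nets.eval n a)) atTop (𝓝 0)}
  zero_mem' := by
    have : (fun n => ordNorm (Nets.eval n (0 : Nets S))) = fun _ => 0 := funext fun n => ordNorm_zero
    simp only [Set.mem_ofPred_eq, this, tendsto_const_nhds]
  add_mem' := by
    intro a b ha hb
    have := Tendsto.add ha hb
    rw [add_zero] at this
    exact squeeze_zero (fun _ => ordNorm_nonneg _) (fun n => ordNorm_add_le _ _) this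
  smul_mem' := by
    intro c a ha
    have := Tendsto.const_mul ‖c‖ ha
    rw [mul_zero] at this
    exact squeeze_zero (fun _ => ordNorm_nonneg _) (fun n => ordNorm_smul_le _ _) this
  star_mem' := by
    intro a ha
    exact squeeze_zero (fun _ => ordNorm_nonneg _) (fun n => ordNorm_star_le _) ha

end Nets

section SoftSystems

open Classical in
/-- Extension of connecting maps by `0` to indices with `¬ m ≤ n`. -/
def extendByZero {N : Type*} [Preorder N] {S : N → Type*} [∀ n, AddCommGroup (S n)]
    [∀ n, Module ℂ (S n)] (j : ∀ {m n : N}, m ≤ n → S m →ₗ[ℂ] S n) (n m : N) :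
    S m →ₗ[ℂ] S n :=
  if h : m ≤ n then j h else 0

/-- Soft inductive systems of operator systems: ucp maps `j_{nm} : S_m → S_n` for `m ≤ n` with
`j_{nn} = id` such that `lim_m limsup_n ‖(j_{nl} - j_{nm} j_{ml}) a_l‖ = 0`. -/
structure SoftInductiveSystem {N : Type*} [Preorder N] (S : N → Type*)
    [∀ n, AddCommGroup (S n)] [∀ n, Module ℂ (S n)] [∀ n, StarAddMonoid (S n)]
    [∀ n, MatrixOrder (S n)] where
  map : ∀ {m n : N}, m ≤ n → S m →ₗ[ℂ] S n
  isUCP : ∀ {m n : N} (h : m ≤ n), IsUCP (map h)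
  map_refl : ∀ n : N, map (le_refl n) = LinearMap.id
  asymptotically_transitive : ∀ (l : N) (a : S l),
    Tendsto (fun m => limsup (fun n => ordNorm (extendByZero map n l a -
      extendByZero map n m (extendByZero map m l a))) atTop) atTop (𝓝 0)

variable {N : Type*} [Preorder N] {S : N → Type*} [∀ n, AddCommGroup (S n)]
  [∀ n, Module ℂ (S n)] [∀ n, StarAddMonoid (S n)] [∀ n, StarModule ℂ (S n)]
  [∀ n, MatrixOrder (S n)]

/-- `j_{nm} : S_m → S_n`, extended by `0` if `¬ m ≤ n`. -/
def SoftInductiveSystem.conn (j : SoftInductiveSystem S) (n m : N) : S m →ₗ[ℂ] S n :=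
  extendByZero j.map n m

/-- Membership in `C(M_ν(S), j^{(ν)})`: the net `a_n ∈ M_ν(S_n)` is uniformly bounded and
`lim_m limsup_n ‖a_n - j_{nm}^{(ν)} a_m‖ = 0`. -/
def SoftInductiveSystem.IsMatConvergent (j : SoftInductiveSystem S) {ν : ℕ}
    (a : ∀ n, Matrix (Fin ν) (Fin ν) (S n)) : Prop :=
  (∃ C : ℝ, ∀ n, matNorm (a n) ≤ C) ∧
    Tendsto (fun m => limsup (fun n => matNorm (a n - (a m).map (j.conn n m))) atTop) atTop (𝓝 0)

variable [IsDirectedOrder N] [Nonempty N]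

theorem tendsto_limsup_iff {f : N → N → ℝ} {C : ℝ} (h0 : ∀ m n, 0 ≤ f m n)
    (hC : ∀ m n, f m n ≤ C) :
    Tendsto (fun m => limsup (f m) atTop) atTop (𝓝 0) ↔
      ∀ ε : ℝ, 0 < ε → ∀ᶠ m in atTop, ∀ᶠ n in atTop, f m n ≤ ε := by
  have hbdd : ∀ m, IsBoundedUnder (· ≤ ·) atTop (f m) := fun m =>
    isBoundedUnder_of ⟨C, hC m⟩
  have hcob : ∀ m, IsCoboundedUnder (· ≤ ·) atTop (f m) := fun m =>
    (isBoundedUnder_of ⟨0, h0 m⟩ : IsBoundedUnder (· ≥ ·) atTop (f m)).isCoboundedUnder_le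
  have hnn : ∀ m, 0 ≤ limsup (f m) atTop := fun m =>
    le_limsup_of_frequently_le (Frequently.of_forall (h0 m)) (hbdd m)
  constructor
  · intro h ε hε
    filter_upwards [h.eventually (gt_mem_nhds hε)] with m hm
    exact (eventually_lt_of_limsup_lt hm (hbdd m)).mono fun n hn => hn.le
  · intro h
    rw [Metric.tendsto_nhds]
    intro ε hε
    filter_upwards [h (ε / 2) (by positivity)] with m hm
    rw [Real.dist_eq, sub_zero, abs_of_nonneg (hnn m)]
    exact (limsup_le_of_le (hcob m) hm).trans_lt (by linarith)

variable [∀ n, IsOperatorSystem (S n)]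

theorem SoftInductiveSystem.ordNorm_conn_le (j : SoftInductiveSystem S) (n m : N) (a : S m) :
    ordNorm (j.conn n m a) ≤ ordNorm a := by
  unfold SoftInductiveSystem.conn extendByZero
  split_ifs with h
  · exact (j.isUCP h).ordNorm_le a
  · simpa [ordNorm_zero] using ordNorm_nonneg a

theorem SoftInductiveSystem.conn_star (j : SoftInductiveSystem S) (n m : N) (a : S m) :
    j.conn n m (star a) = star (j.conn n m a) := by
  unfold SoftInductiveSystem.conn extendByZero
  split_ifs with h
  · exact (j.isUCP h).map_star a
  · simp

/-- A bounded net is `j`-convergent if `lim_m limsup_n ‖a_n - j_{nm} a_m‖ = 0`. -/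
def SoftInductiveSystem.IsConvergent (j : SoftInductiveSystem S) (a : Nets S) : Prop :=
  Tendsto (fun m => limsup (fun n => ordNorm (Nets.eval n a - j.conn n m (Nets.eval m a))) atTop) atTop (𝓝 0)

theorem SoftInductiveSystem.isConvergent_iff (j : SoftInductiveSystem S) (a : Nets S) :
    j.IsConvergent a ↔ ∀ ε : ℝ, 0 < ε → ∀ᶠ m in atTop, ∀ᶠ n in atTop,
      ordNorm (Nets.eval n a - j.conn n m (Nets.eval m a)) ≤ ε := by
  obtain ⟨C, hC⟩ := a.2
  exact tendsto_limsup_iff (C := C + C) (fun m n => ordNorm_nonneg _) fun m n =>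
    (ordNorm_sub_le _ _).trans (add_le_add (hC n) ((j.ordNorm_conn_le n m _).trans (hC m)))

/-- The operator system `C(S, j)` of `j`-convergent nets, as a subsystem of the bounded nets. -/
def SoftInductiveSystem.convNets (j : SoftInductiveSystem S) : UnitalSubspace (Nets S) where
  carrier := {a | j.IsConvergent a}
  zero_mem' := by
    rw [Set.mem_ofPred_eq, j.isConvergent_iff]
    refine fun ε hε => Eventually.of_forall fun m => Eventually.of_forall fun n => ?_
    have : Nets.eval n (0 : Nets S) - j.conn n m (Nets.eval m (0 : Nets S)) = 0 := by
      simp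
    rw [this, ordNorm_zero]
    exact hε.le
  add_mem' := by
    intro a b ha hb
    rw [Set.mem_ofPred_eq, j.isConvergent_iff] at *
    intro ε hε
    filter_upwards [ha (ε / 2) (by positivity), hb (ε / 2) (by positivity)] with m h1 h2
    filter_upwards [h1, h2] with n h3 h4
    have : Nets.eval n (a + b) - j.conn n m (Nets.eval m (a + b)) =
        (Nets.eval n a - j.conn n m (Nets.eval m a)) + (Nets.eval n b - j.conn n m (Nets.eval m b)) := by
      simp only [map_add]
      abel
    rw [this]
    exact (ordNorm_add_le _ _).trans (by linarith)
  smul_mem' := by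
    intro c a ha
    rw [Set.mem_ofPred_eq, j.isConvergent_iff] at *
    intro ε hε
    filter_upwards [ha (ε / (‖c‖ + 1)) (by positivity)] with m h1
    filter_upwards [h1] with n h2
    have : Nets.eval n (c • a) - j.conn n m (Nets.eval m (c • a)) = c • (Nets.eval n a - j.conn n m (Nets.eval m a)) := by
      simp only [map_smul, smul_sub]
    rw [this]
    refine (ordNorm_smul_le _ _).trans ((mul_le_mul_of_nonneg_left h2 (norm_nonneg c)).trans ?_)
    rw [mul_div_assoc', div_le_iff₀ (by positivity)]
    nlinarith [norm_nonneg c]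
  star_mem' := by
    intro a ha
    rw [Set.mem_ofPred_eq, j.isConvergent_iff] at *
    intro ε hε
    filter_upwards [ha ε hε] with m h1
    filter_upwards [h1] with n h2
    have : Nets.eval n (star a) - j.conn n m (Nets.eval m (star a)) = star (Nets.eval n a - j.conn n m (Nets.eval m a)) := by
      rw [star_sub, ← j.conn_star]
      rfl
    rw [this]
    exact (ordNorm_star_le _).trans h2
  unit_mem' := by
    rw [Set.mem_ofPred_eq, j.isConvergent_iff]
    refine fun ε hε => Eventually.of_forall fun m => ?_
    filter_upwards [eventually_ge_atTop m] with n hn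
    have : Nets.eval n (MatrixOrder.unit : Nets S) - j.conn n m (Nets.eval m (MatrixOrder.unit : Nets S)) = 0 := by
      have h : j.conn n m = j.map hn := by simp [SoftInductiveSystem.conn, extendByZero, hn]
      rw [h]
      exact sub_eq_zero.2 (j.isUCP hn).map_unit.symm
    rw [this, ordNorm_zero]
    exact hε.le

/-- The null nets as a subspace of the `j`-convergent nets. -/
def SoftInductiveSystem.nullConvNets (j : SoftInductiveSystem S) :
    SelfAdjointSubspace j.convNets.Elem :=
  (nullNets S).restrict j.convNets

/-- The limit space `S_∞ = C(S, j)/C_0`. -/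
abbrev SoftInductiveSystem.Limit (j : SoftInductiveSystem S) : Type _ :=
  j.nullConvNets.Quotient

/-- The quotient of the bounded nets by the null nets. -/
abbrev NetsQuotient (S : N → Type*) [∀ n, AddCommGroup (S n)] [∀ n, Module ℂ (S n)]
    [∀ n, StarAddMonoid (S n)] [∀ n, StarModule ℂ (S n)] [∀ n, MatrixOrder (S n)]
    [∀ n, IsOperatorSystem (S n)] : Type _ := (nullNets S).Quotient

/-- The induced map `C(S, j)/C_0 → ∏_n S_n / C_0`. -/
def SoftInductiveSystem.limitInclusion (j : SoftInductiveSystem S) :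
    j.Limit →ₗ[ℂ] NetsQuotient S :=
  Submodule.mapQ _ _ j.convNets.incl le_rfl

end SoftSystems

section CStarAlgebras

/-- The matrix order of a unital C*-algebra: `M_ν(A)⁺` are the positive elements of the
C*-algebra `M_ν(A)`. -/
instance (A : Type*) [CStarAlgebra A] : MatrixOrder A where
  unit := 1
  cone ν :=
    letI := CStarAlgebra.spectralOrder A
    letI := CStarAlgebra.spectralOrderedRing A
    {a | 0 ≤ (CStarMatrix.ofMatrix a : CStarMatrix (Fin ν) (Fin ν) A)}

variable {N : Type*} [Preorder N] [IsDirectedOrder N] [Nonempty N]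

/-- The ideal `⊕_n A_n` of null nets in the C*-algebra `∏_n A_n` of bounded nets. -/
def cstarNull (A : N → Type*) [∀ n, CStarAlgebra (A n)] : Submodule ℂ (lp A ∞) where
  carrier := {a | Tendsto (fun n => ‖a n‖) atTop (𝓝 0)}
  zero_mem' := by simp
  add_mem' := by
    intro a b ha hb
    have := Tendsto.add ha hb
    rw [add_zero] at this
    exact squeeze_zero (fun _ => norm_nonneg _) (fun n => norm_add_le (a n) (b n)) this
  smul_mem' := by
    intro c a ha
    have := Tendsto.const_mul ‖c‖ ha
    rw [mul_zero] at this
    exact squeeze_zero (fun _ => norm_nonneg _) (fun n => norm_smul_le c (a n)) this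

variable {A : N → Type*} [∀ n, CStarAlgebra (A n)]

theorem cstarNull_mem_iff {a : lp A ∞} :
    a ∈ cstarNull A ↔ ∀ ε : ℝ, 0 < ε → ∀ᶠ n in atTop, ‖a n‖ ≤ ε := by
  change Tendsto _ _ _ ↔ _
  rw [Metric.tendsto_nhds]
  simp only [dist_zero_right, norm_norm]
  refine ⟨fun h ε hε => (h ε hε).mono fun n hn => hn.le, fun h ε hε => ?_⟩
  filter_upwards [h (ε / 2) (by positivity)] with n hn
  linarith

theorem cstarNull_mul_left (a : lp A ∞) {b : lp A ∞} (hb : b ∈ cstarNull A) :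
    a * b ∈ cstarNull A := by
  have := Tendsto.const_mul ‖a‖ hb
  rw [mul_zero] at this
  refine squeeze_zero (fun _ => norm_nonneg _) (fun n => ?_) this
  exact (norm_mul_le (a n) (b n)).trans
    (mul_le_mul_of_nonneg_right (lp.norm_apply_le_norm ENNReal.top_ne_zero a n) (norm_nonneg _))

theorem cstarNull_mul_right {a : lp A ∞} (ha : a ∈ cstarNull A) (b : lp A ∞) :
    a * b ∈ cstarNull A := by
  have := Tendsto.mul_const ‖b‖ ha
  rw [zero_mul] at this
  refine squeeze_zero (fun _ => norm_nonneg _) (fun n => ?_) this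
  exact (norm_mul_le (a n) (b n)).trans
    (mul_le_mul_of_nonneg_left (lp.norm_apply_le_norm ENNReal.top_ne_zero b n) (norm_nonneg _))

theorem cstarNull_star {a : lp A ∞} (ha : a ∈ cstarNull A) : star a ∈ cstarNull A := by
  refine squeeze_zero (fun _ => norm_nonneg _) (fun n => ?_) ha
  exact (norm_star (a n)).le

instance cstarNull_isClosed : IsClosed (cstarNull A : Set (lp A ∞)) := by
  refine isClosed_of_closure_subset fun a ha => ?_
  rw [SetLike.mem_coe, cstarNull_mem_iff]
  intro ε hε
  obtain ⟨b, hb, hab⟩ := Metric.mem_closure_iff.1 ha (ε / 2) (by positivity)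
  filter_upwards [cstarNull_mem_iff.1 hb (ε / 2) (by positivity)] with n hn
  have h1 : ‖(a - b) n‖ ≤ ‖a - b‖ := lp.norm_apply_le_norm ENNReal.top_ne_zero _ n
  have h2 : ‖a n‖ ≤ ‖(a - b) n‖ + ‖b n‖ := by
    simpa using norm_add_le ((a - b) n) (b n)
  rw [dist_eq_norm] at hab
  linarith

/-- The quotient `∏_n A_n / ⊕_n A_n`. -/
def CStarQuotient (A : N → Type*) [∀ n, CStarAlgebra (A n)] : Type _ := lp A ∞ ⧸ cstarNull A

namespace CStarQuotient

instance : NormedAddCommGroup (CStarQuotient A) :=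
  inferInstanceAs (NormedAddCommGroup (lp A ∞ ⧸ cstarNull A))

instance : NormedSpace ℂ (CStarQuotient A) :=
  inferInstanceAs (NormedSpace ℂ (lp A ∞ ⧸ cstarNull A))

instance : CompleteSpace (CStarQuotient A) :=
  inferInstanceAs (CompleteSpace (lp A ∞ ⧸ cstarNull A))

/-- The quotient map `∏_n A_n → ∏_n A_n / ⊕_n A_n`. -/
def mk : lp A ∞ →ₗ[ℂ] CStarQuotient A := (cstarNull A).mkQ

theorem mk_surjective : Function.Surjective (mk (A := A)) := (cstarNull A).mkQ_surjective

theorem mk_eq_mk {a b : lp A ∞} : mk a = mk b ↔ a - b ∈ cstarNull A :=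
  Submodule.Quotient.eq _

theorem norm_mk_le_iff {a : lp A ∞} {r : ℝ} (hr : 0 ≤ r) :
    ‖mk a‖ ≤ r ↔ ∀ ε : ℝ, 0 < ε → ∀ᶠ n in atTop, ‖a n‖ ≤ r + ε := by
  constructor
  · intro h ε hε
    obtain ⟨b, hb, hbn⟩ := Submodule.Quotient.norm_mk_lt (S := cstarNull A) (mk a)
      (show 0 < ε / 2 by positivity)
    have hab : a - b ∈ cstarNull A := mk_eq_mk.1 hb.symm
    filter_upwards [cstarNull_mem_iff.1 hab (ε / 2) (by positivity)] with n hn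
    have h1 : ‖b n‖ ≤ ‖b‖ := lp.norm_apply_le_norm ENNReal.top_ne_zero _ n
    have h2 : ‖a n‖ ≤ ‖(a - b) n‖ + ‖b n‖ := by
      simpa using norm_add_le ((a - b) n) (b n)
    have h3 : ‖b‖ < ‖mk a‖ + ε / 2 := hbn
    linarith
  · intro h
    refine le_of_forall_pos_le_add fun ε hε => ?_
    classical
    let b : ∀ n, A n := fun n => if ‖a n‖ ≤ r + ε then a n else 0
    have hb : ∀ n, ‖b n‖ ≤ r + ε := fun n => by
      by_cases hn : ‖a n‖ ≤ r + ε
      · simp [b, hn]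
      · simp only [b, hn, if_false, norm_zero]; positivity
    let b' : lp A ∞ := ⟨b, memℓp_infty ⟨r + ε, by rintro _ ⟨n, rfl⟩; exact hb n⟩⟩
    have hab : mk a = mk b' := by
      rw [mk_eq_mk, cstarNull_mem_iff]
      intro δ hδ
      filter_upwards [h ε hε] with n hn
      have : (a - b') n = 0 := by
        change a n - b n = 0
        simp [b, hn]
      rw [this, norm_zero]
      exact hδ.le
    rw [hab]
    exact (Submodule.Quotient.norm_mk_le (cstarNull A) b').trans
      (lp.norm_le_of_forall_le (by positivity) hb)

instance : Mul (CStarQuotient A) where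
  mul := Quotient.map₂ (· * ·) fun a a' ha b b' hb => by
    have ha' := (Submodule.quotientRel_def _).1 ha
    have hb' := (Submodule.quotientRel_def _).1 hb
    refine (Submodule.quotientRel_def _).2 ?_
    have : a * b - a' * b' = (a - a') * b + a' * (b - b') := by
      rw [sub_mul, mul_sub]; abel
    rw [this]
    exact add_mem (cstarNull_mul_right ha' b) (cstarNull_mul_left a' hb')

theorem mk_mul (a b : lp A ∞) : mk (a * b) = mk a * mk b := rfl

/-- The unit of `∏_n A_n`. -/
def oneNet (A : N → Type*) [∀ n, CStarAlgebra (A n)] : lp A ∞ :=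
  ⟨fun _ => 1, memℓp_infty ⟨1, by
    rintro _ ⟨n, rfl⟩
    rcases subsingleton_or_nontrivial (A n) with h | h
    · simp [Subsingleton.elim (1 : A n) 0]
    · exact CStarRing.norm_one.le⟩⟩

instance : Ring (CStarQuotient A) where
  __ := (inferInstance : AddCommGroup (CStarQuotient A))
  mul := (· * ·)
  one := mk (oneNet A)
  zero_mul := by rintro ⟨a⟩; exact congrArg mk (zero_mul a)
  mul_zero := by rintro ⟨a⟩; exact congrArg mk (mul_zero a)
  mul_assoc := by rintro ⟨a⟩ ⟨b⟩ ⟨c⟩; exact congrArg mk (mul_assoc a b c)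
  left_distrib := by rintro ⟨a⟩ ⟨b⟩ ⟨c⟩; exact congrArg mk (mul_add a b c)
  right_distrib := by rintro ⟨a⟩ ⟨b⟩ ⟨c⟩; exact congrArg mk (add_mul a b c)
  one_mul := by
    rintro ⟨a⟩
    exact congrArg mk (show oneNet A * a = a from lp.ext (funext fun n => one_mul (a n)))
  mul_one := by
    rintro ⟨a⟩
    exact congrArg mk (show a * oneNet A = a from lp.ext (funext fun n => mul_one (a n)))

theorem mk_one : mk (oneNet A) = 1 := rfl

instance : StarRing (CStarQuotient A) where
  star := Quotient.map star fun a b h => by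
    refine (Submodule.quotientRel_def _).2 ?_
    rw [← star_sub]
    exact cstarNull_star ((Submodule.quotientRel_def _).1 h)
  star_involutive := by rintro ⟨a⟩; exact congrArg mk (star_star a)
  star_add := by rintro ⟨a⟩ ⟨b⟩; exact congrArg mk (star_add a b)
  star_mul := by rintro ⟨a⟩ ⟨b⟩; exact congrArg mk (star_mul a b)

theorem mk_star (a : lp A ∞) : mk (star a) = star (mk a) := rfl

instance : NormedRing (CStarQuotient A) where
  __ := (inferInstance : NormedAddCommGroup (CStarQuotient A))
  __ := (inferInstance : Ring (CStarQuotient A))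
  norm_mul_le := by
    intro x y
    obtain ⟨a, rfl⟩ := mk_surjective x
    obtain ⟨b, rfl⟩ := mk_surjective y
    rw [← mk_mul, norm_mk_le_iff (by positivity)]
    intro ε hε
    set r := ‖mk a‖
    set s := ‖mk b‖
    have hr : 0 ≤ r := norm_nonneg _
    have hs : 0 ≤ s := norm_nonneg _
    let δ := min 1 (ε / (r + s + 1))
    have hδ : 0 < δ := lt_min one_pos (by positivity)
    have hδ1 : δ ≤ 1 := min_le_left _ _
    have hδ2 : δ * (r + s + 1) ≤ ε :=
      (le_div_iff₀ (by positivity)).1 (min_le_right _ _)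
    filter_upwards [(norm_mk_le_iff hr).1 le_rfl δ hδ, (norm_mk_le_iff hs).1 le_rfl δ hδ]
      with n h1 h2
    calc ‖(a * b) n‖ ≤ ‖a n‖ * ‖b n‖ := norm_mul_le _ _
      _ ≤ (r + δ) * (s + δ) := mul_le_mul h1 h2 (norm_nonneg _) (by positivity)
      _ ≤ r * s + ε := by nlinarith

instance : CStarRing (CStarQuotient A) where
  norm_mul_self_le := by
    intro x
    obtain ⟨a, rfl⟩ := mk_surjective x
    rw [← mk_star, ← mk_mul]
    set r := ‖mk (star a * a)‖
    have hr : 0 ≤ r := norm_nonneg _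
    have h : ‖mk a‖ ≤ √r := by
      rw [norm_mk_le_iff (Real.sqrt_nonneg r)]
      intro ε hε
      filter_upwards [(norm_mk_le_iff hr).1 le_rfl (ε ^ 2) (by positivity)] with n hn
      have h1 : ‖(star a * a) n‖ = ‖a n‖ * ‖a n‖ := CStarRing.norm_star_mul_self
      rw [h1] at hn
      refine abs_le_of_sq_le_sq' ?_ (by positivity) |>.2
      nlinarith [Real.sq_sqrt hr, Real.sqrt_nonneg r]
    calc ‖mk a‖ * ‖mk a‖ ≤ √r * √r := mul_le_mul h h (norm_nonneg _) (Real.sqrt_nonneg r)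
      _ = r := Real.mul_self_sqrt hr

instance : NormedAlgebra ℂ (CStarQuotient A) where
  __ := Algebra.ofModule
    (fun c x y => by
      obtain ⟨a, rfl⟩ := mk_surjective x
      obtain ⟨b, rfl⟩ := mk_surjective y
      exact congrArg mk (smul_mul_assoc c a b))
    (fun c x y => by
      obtain ⟨a, rfl⟩ := mk_surjective x
      obtain ⟨b, rfl⟩ := mk_surjective y
      exact congrArg mk (mul_smul_comm c a b))
  norm_smul_le := norm_smul_le

instance : StarModule ℂ (CStarQuotient A) where
  star_smul := by
    intro c x
    obtain ⟨a, rfl⟩ := mk_surjective x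
    exact congrArg mk (star_smul c a)

/-- `∏_n A_n / ⊕_n A_n` is a unital C*-algebra. -/
instance : CStarAlgebra (CStarQuotient A) where

end CStarQuotient

end CStarAlgebras

end

end SoftLimits

namespace SoftLimits

set_option linter.unusedSectionVars false

/-! ### Order norms of hermitian, positive and general matrices. -/

section OrderNorms

variable {S : Type*} [AddCommGroup S] [Module ℂ S] [StarAddMonoid S] [StarModule ℂ S]
  [MatrixOrder S] {ν : ℕ}

/-- The hermitian part `(a + a*) / 2` of a matrix. -/
noncomputable def hermPart (a : Matrix (Fin ν) (Fin ν) S) : Matrix (Fin ν) (Fin ν) S :=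
  (1 / 2 : ℂ) • (a + a.conjTranspose)

theorem hermPart_conjTranspose (a : Matrix (Fin ν) (Fin ν) S) :
    (hermPart a).conjTranspose = hermPart a := by
  ext i j
  simp [hermPart, add_comm]

theorem hermPart_of_conjTranspose_eq {a : Matrix (Fin ν) (Fin ν) S} (ha : a.conjTranspose = a) :
    hermPart a = a := by
  rw [hermPart, ha]
  module

theorem hermPart_add (a b : Matrix (Fin ν) (Fin ν) S) :
    hermPart (a + b) = hermPart a + hermPart b := by
  simp only [hermPart, Matrix.conjTranspose_add]
  module

theorem sub_hermPart (a : Matrix (Fin ν) (Fin ν) S) :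
    a - hermPart a = (1 / 2 : ℂ) • (a - a.conjTranspose) := by
  rw [hermPart]
  module

variable [IsOperatorSystem S]

open IsOperatorSystem

theorem scalarUnit_conjTranspose (r : ℝ) :
    (scalarUnit ν r : Matrix (Fin ν) (Fin ν) S).conjTranspose = scalarUnit ν r := by
  ext i j
  by_cases h : i = j
  · subst h; simp [scalarUnit, star_unit]
  · simp [scalarUnit, h, Ne.symm h]

theorem normBlock_conjTranspose (r : ℝ) (a : Matrix (Fin ν) (Fin ν) S) :
    (normBlock r a).conjTranspose = normBlock r a := by
  rw [normBlock_eq, Matrix.conjTranspose_add, scalarUnit_conjTranspose,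
    normBlock_zero_conjTranspose]

theorem scalarUnit_add_mem_mono {r s : ℝ} (hrs : r ≤ s) {a : Matrix (Fin ν) (Fin ν) S}
    (h : scalarUnit ν r + a ∈ MatrixOrder.cone ν) : scalarUnit ν s + a ∈ MatrixOrder.cone ν := by
  have := add_mem (scalarUnit_mem (S := S) ν (sub_nonneg.2 hrs)) h
  rwa [← add_assoc, ← scalarUnit_add, sub_add_cancel] at this

/-- Compressing the block matrix by the column `(1, c)` gives `r + c² r + 2 c a`, which is twice the
required element because `c² = 1`. -/
theorem scalarUnit_add_smul_mem_of_normBlock_mem {r : ℝ} {a : Matrix (Fin ν) (Fin ν) S}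
    (ha : a.conjTranspose = a) (h : normBlock r a ∈ MatrixOrder.cone (ν + ν)) {c : ℝ}
    (hc : c * c = 1) : scalarUnit ν r + (c : ℂ) • a ∈ MatrixOrder.cone ν := by
  let X : Matrix (Fin (ν + ν)) (Fin ν) ℂ := Matrix.of fun k p =>
    Fin.addCases (fun i => if i = p then (1 : ℂ) else 0) (fun i => if i = p then (c : ℂ) else 0) k
  have hX := smul_mem (r := 1 / 2) (by norm_num) (conjBy_mem X h)
  have hcc : (c : ℂ) * c = 1 := by exact_mod_cast hc
  have haa : ∀ p q, star (a q p) = a p q := fun p q => congrFun (congrFun ha p) q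
  convert hX using 1
  ext p q
  simp [conjBy, X, -Fin.natAdd_eq_addNat, Fin.sum_univ_add, haa, hcc,
    Finset.sum_add_distrib, ite_smul, apply_ite (starRingEnd ℂ), ite_mul]
  module

/-- `[[r, a], [a, r]] ≥ 0` if and only if `-r ≤ a ≤ r`, for hermitian `a`. -/
theorem normBlock_mem_iff {r : ℝ} {a : Matrix (Fin ν) (Fin ν) S} (ha : a.conjTranspose = a) :
    normBlock r a ∈ MatrixOrder.cone (ν + ν) ↔
      scalarUnit ν r + a ∈ MatrixOrder.cone ν ∧ scalarUnit ν r - a ∈ MatrixOrder.cone ν := by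
  constructor
  · intro h
    constructor
    · simpa using scalarUnit_add_smul_mem_of_normBlock_mem ha h (c := 1) (by norm_num)
    · simpa [sub_eq_add_neg] using
        scalarUnit_add_smul_mem_of_normBlock_mem ha h (c := -1) (by norm_num)
  · rintro ⟨h₁, h₂⟩
    -- `X c` is the row `(1, c)`. Inflating `r + a` by `(1, 1)` and `r - a` by `(1, -1)` and
    -- averaging leaves `r` on the diagonal and `a` off it.
    let X (c : ℂ) : Matrix (Fin ν) (Fin (ν + ν)) ℂ := Matrix.of fun p k =>
      if p = Fin.addCases id id k then (Fin.addCases (fun _ => 1) (fun _ => c) k : ℂ) else 0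
    have h := smul_mem (r := 1 / 2) (by norm_num)
      (add_mem (conjBy_mem (X 1) h₁) (conjBy_mem (X (-1)) h₂))
    rw [conjBy_submatrix, conjBy_submatrix] at h
    have haa : ∀ p q, star (a q p) = a p q := fun p q => congrFun (congrFun ha p) q
    convert h using 1
    refine block_ext (fun i j => ?_) (fun i j => ?_) (fun i j => ?_) (fun i j => ?_) <;>
    simp [-Fin.natAdd_eq_addNat, haa] <;> module

theorem scalarUnit_add_mem_of_matNorm_le {r : ℝ} {a : Matrix (Fin ν) (Fin ν) S}
    (ha : a.conjTranspose = a) (h : matNorm a ≤ r) : scalarUnit ν r + a ∈ MatrixOrder.cone ν :=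
  ((normBlock_mem_iff ha).1 (normBlock_mono h (normBlock_matNorm_mem a))).1

theorem matNorm_zero : matNorm (0 : Matrix (Fin ν) (Fin ν) S) = 0 :=
  le_antisymm (by simpa using matNorm_smul_le 0 (0 : Matrix (Fin ν) (Fin ν) S)) (matNorm_nonneg _)

theorem matNorm_neg_le (a : Matrix (Fin ν) (Fin ν) S) : matNorm (-a) ≤ matNorm a := by
  simpa using matNorm_smul_le (-1) a

theorem matNorm_sub_le (a b : Matrix (Fin ν) (Fin ν) S) :
    matNorm (a - b) ≤ matNorm a + matNorm b := by
  rw [sub_eq_add_neg]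
  exact (matNorm_add_le a (-b)).trans (add_le_add_right (matNorm_neg_le b) _)

theorem scalarUnit_sub_mem_of_matNorm_le {r : ℝ} {a : Matrix (Fin ν) (Fin ν) S}
    (ha : a.conjTranspose = a) (h : matNorm a ≤ r) : scalarUnit ν r - a ∈ MatrixOrder.cone ν :=
  ((normBlock_mem_iff ha).1 (normBlock_mono h (normBlock_matNorm_mem a))).2

theorem matNorm_hermPart_le (a : Matrix (Fin ν) (Fin ν) S) : matNorm (hermPart a) ≤ matNorm a := by
  refine (matNorm_smul_le _ _).trans ?_
  have h₁ := matNorm_add_le a a.conjTranspose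
  have h₂ := matNorm_conjTranspose_le a
  norm_num
  linarith

theorem matNorm_scalarUnit_le {r : ℝ} (hr : 0 ≤ r) :
    matNorm (scalarUnit ν r : Matrix (Fin ν) (Fin ν) S) ≤ r := by
  refine matNorm_le hr ((normBlock_mem_iff (scalarUnit_conjTranspose r)).2 ⟨?_, ?_⟩)
  · exact add_mem (scalarUnit_mem ν hr) (scalarUnit_mem ν hr)
  · rw [sub_self]
    exact zero_mem ν

/-- Selecting the coordinates `i` and `ν + j` compresses the norm block of `a` to that of its `(i,
j)` entry. -/
theorem ordNorm_apply_le_matNorm (a : Matrix (Fin ν) (Fin ν) S) (i j : Fin ν) :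
    ordNorm (a i j) ≤ matNorm a := by
  refine matNorm_le (matNorm_nonneg a) ?_
  have h := conjBy_mem (n := 1 + 1) (Matrix.of fun k p => if k =
    (Fin.addCases (fun _ => Fin.castAdd ν i) (fun _ => Fin.natAdd ν j) p : Fin (ν + ν)) then
    (1 : ℂ) else 0) (normBlock_matNorm_mem a)
  rw [conjBy_submatrix _ (fun _ => (1 : ℂ))] at h
  convert h using 1
  refine block_ext (fun i j => ?_) (fun i j => ?_) (fun i j => ?_) (fun i j => ?_) <;>
  simp [-Fin.natAdd_eq_addNat, -Fin.natAdd_zero, -Fin.castAdd_zero, scalarUnit,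
    Subsingleton.elim i j]

/-- The entrywise lower bound for hermitian matrices is applied to the norm block with zero
diagonal; its size accounts for the factor `ν + ν`. The constant is crude, but only convergence
depends on it. -/
theorem matNorm_le_of_entries {a : Matrix (Fin ν) (Fin ν) S} {C : ℝ} (hC : 0 ≤ C)
    (h : ∀ i j, ordNorm (a i j) ≤ C) : matNorm a ≤ (ν + ν : ℕ) * C := by
  refine matNorm_le (by positivity) ?_
  rw [normBlock_eq]
  refine scalarUnit_add_mem_of_entries (normBlock_zero_conjTranspose a) fun i j => ?_
  have h0 : ∀ i j, ordNorm ((scalarUnit ν 0 : Matrix (Fin ν) (Fin ν) S) i j) ≤ C := fun i j => by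
    simpa [scalarUnit, ordNorm_zero] using hC
  refine Fin.addCases (fun i => ?_) (fun i => ?_) i <;>
  refine Fin.addCases (fun j => ?_) (fun j => ?_) j
  · rw [normBlock_ll]; exact h0 i j
  · rw [normBlock_lr]; exact h i j
  · rw [normBlock_rl]; exact (ordNorm_star_le _).trans (h j i)
  · rw [normBlock_rr]; exact h0 i j

/-- The least `r ≥ 0` with `r 1 + a ≥ 0`. -/
noncomputable def negBound (a : Matrix (Fin ν) (Fin ν) S) : ℝ :=
  sInf {r : ℝ | 0 ≤ r ∧ scalarUnit ν r + a ∈ MatrixOrder.cone ν}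

theorem negBound_nonneg (a : Matrix (Fin ν) (Fin ν) S) : 0 ≤ negBound a :=
  Real.sInf_nonneg fun _ h => h.1

theorem negBound_le {a : Matrix (Fin ν) (Fin ν) S} {r : ℝ} (hr : 0 ≤ r)
    (h : scalarUnit ν r + a ∈ MatrixOrder.cone ν) : negBound a ≤ r :=
  csInf_le ⟨0, fun _ h => h.1⟩ ⟨hr, h⟩

/-- The Archimedean axiom makes the infimum attained; hermiticity ensures that the defining set is
nonempty, as it contains the norm. -/
theorem scalarUnit_negBound_add_mem {a : Matrix (Fin ν) (Fin ν) S} (ha : a.conjTranspose = a) :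
    scalarUnit ν (negBound a) + a ∈ MatrixOrder.cone ν := by
  refine archimedean fun r hr => ?_
  have hne : {r : ℝ | 0 ≤ r ∧ scalarUnit ν r + a ∈ MatrixOrder.cone ν}.Nonempty :=
    ⟨matNorm a, matNorm_nonneg a, scalarUnit_add_mem_of_matNorm_le ha le_rfl⟩
  obtain ⟨s, hs, hsr⟩ := exists_lt_of_csInf_lt hne (lt_add_of_pos_right (negBound a) hr)
  rw [← add_assoc, ← scalarUnit_add, add_comm r]
  exact scalarUnit_add_mem_mono hsr.le hs.2

/-- Here `0 ≤ a ≤ a + b ≤ ‖a + b‖ 1`. This makes the null nets hereditary, which in turn makes the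
quotient cones proper. -/
theorem matNorm_le_matNorm_add {a b : Matrix (Fin ν) (Fin ν) S}
    (ha : a ∈ MatrixOrder.cone ν) (hb : b ∈ MatrixOrder.cone ν) : matNorm a ≤ matNorm (a + b) := by
  refine matNorm_le (matNorm_nonneg _) ((normBlock_mem_iff (conjTranspose_eq ha)).2 ⟨?_, ?_⟩)
  · exact add_mem (scalarUnit_mem ν (matNorm_nonneg _)) ha
  · have h := add_mem hb
      (scalarUnit_sub_mem_of_matNorm_le (conjTranspose_eq (add_mem ha hb)) le_rfl)
    convert h using 1
    abel

variable {T : Type*} [AddCommGroup T] [Module ℂ T] [StarAddMonoid T] [StarModule ℂ T]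
  [MatrixOrder T]

theorem map_scalarUnit_of_map_unit {φ : S →ₗ[ℂ] T} (hφ : φ MatrixOrder.unit = MatrixOrder.unit)
    (r : ℝ) : (scalarUnit ν r : Matrix (Fin ν) (Fin ν) S).map φ = scalarUnit ν r := by
  ext i j
  by_cases h : i = j <;> simp [scalarUnit, h, hφ]

theorem map_normBlock {φ : S →ₗ[ℂ] T} (hφ : φ MatrixOrder.unit = MatrixOrder.unit)
    (hs : ∀ a, φ (star a) = star (φ a)) (r : ℝ) (a : Matrix (Fin ν) (Fin ν) S) :
    (normBlock r a).map φ = normBlock r (a.map φ) := by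
  have h := map_scalarUnit_of_map_unit (ν := ν) hφ r
  have h' : ∀ i j, φ (scalarUnit ν r i j) = scalarUnit ν r i j := fun i j =>
    congrFun (congrFun h i) j
  refine block_ext (fun i j => ?_) (fun i j => ?_) (fun i j => ?_) (fun i j => ?_) <;>
  simp [-Fin.natAdd_eq_addNat, h', hs]

theorem map_conjTranspose_of_map_star {φ : S →ₗ[ℂ] T} (hs : ∀ a, φ (star a) = star (φ a))
    (a : Matrix (Fin ν) (Fin ν) S) : a.conjTranspose.map φ = (a.map φ).conjTranspose := by
  ext i j
  simp [hs]

theorem map_hermPart {φ : S →ₗ[ℂ] T} (hs : ∀ a, φ (star a) = star (φ a))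
    (a : Matrix (Fin ν) (Fin ν) S) : (hermPart a).map φ = hermPart (a.map φ) := by
  ext i j
  simp [hermPart, hs]

theorem matrix_map_add {ι : Type*} (φ : S →ₗ[ℂ] T) (a b : Matrix ι ι S) :
    (a + b).map φ = a.map φ + b.map φ := by
  ext i j
  simp

theorem IsUCP.matNorm_map_le [IsOperatorSystem T] {φ : S →ₗ[ℂ] T} (hφ : IsUCP φ)
    (a : Matrix (Fin ν) (Fin ν) S) : matNorm (a.map φ) ≤ matNorm a := by
  refine matNorm_le (matNorm_nonneg a) ?_
  rw [← map_normBlock hφ.map_unit hφ.map_star]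
  exact hφ.map_cone _ _ (normBlock_matNorm_mem a)

end OrderNorms

/-! ### Quotients by order proximinal subspaces. -/

section Quotients

variable {T : Type*} [AddCommGroup T] [Module ℂ T] [StarAddMonoid T] [StarModule ℂ T]
  [MatrixOrder T] {J : SelfAdjointSubspace T} {ν : ℕ}

theorem SelfAdjointSubspace.quotMap_surjective (J : SelfAdjointSubspace T) :
    Function.Surjective J.quotMap :=
  J.toSubmodule.mkQ_surjective

theorem SelfAdjointSubspace.ker_quotMap (J : SelfAdjointSubspace T) :
    LinearMap.ker J.quotMap = J.toSubmodule :=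
  J.toSubmodule.ker_mkQ

theorem SelfAdjointSubspace.quotMap_eq_zero {a : T} : J.quotMap a = 0 ↔ a ∈ J.toSubmodule :=
  Submodule.Quotient.mk_eq_zero _

theorem SelfAdjointSubspace.quotMap_star (J : SelfAdjointSubspace T) (a : T) :
    J.quotMap (star a) = star (J.quotMap a) := rfl

theorem SelfAdjointSubspace.quotMap_unit (J : SelfAdjointSubspace T) :
    J.quotMap MatrixOrder.unit = MatrixOrder.unit := rfl

theorem SelfAdjointSubspace.exists_map_quotMap_eq (x : Matrix (Fin ν) (Fin ν) J.Quotient) :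
    ∃ a : Matrix (Fin ν) (Fin ν) T, a.map J.quotMap = x := by
  choose f hf using J.quotMap_surjective
  exact ⟨x.map f, by ext i j; exact hf _⟩

theorem SelfAdjointSubspace.map_quotMap_eq_iff {a b : Matrix (Fin ν) (Fin ν) T} :
    a.map J.quotMap = b.map J.quotMap ↔ ∀ i j, (a - b) i j ∈ J.toSubmodule := by
  simp only [← quotMap_eq_zero, ← Matrix.ext_iff, Matrix.map_apply, Matrix.sub_apply, map_sub,
    sub_eq_zero]

theorem SelfAdjointSubspace.map_add_quotMap {a b : Matrix (Fin ν) (Fin ν) T}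
    (hb : ∀ i j, b i j ∈ J.toSubmodule) : (a + b).map J.quotMap = a.map J.quotMap :=
  map_quotMap_eq_iff.2 (by simpa using hb)

/-- The cone is defined through some representative; the difference of two representatives can be
absorbed into `b`, so any representative serves. -/
theorem SelfAdjointSubspace.map_quotMap_mem_cone_iff {a : Matrix (Fin ν) (Fin ν) T} :
    a.map J.quotMap ∈ MatrixOrder.cone ν ↔ ∀ ε : ℝ, 0 < ε → ∃ b : Matrix (Fin ν) (Fin ν) T,
      (∀ i j, b i j ∈ J.toSubmodule) ∧ scalarUnit ν ε + a + b ∈ MatrixOrder.cone ν := by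
  constructor
  · rintro ⟨c, hc, h⟩ ε hε
    obtain ⟨b, hb, hbc⟩ := h ε hε
    refine ⟨c - a + b, fun i j => add_mem (map_quotMap_eq_iff.1 hc i j) (hb i j), ?_⟩
    convert hbc using 1
    abel
  · exact fun h => ⟨a, rfl, h⟩

variable [IsOperatorSystem T]

theorem SelfAdjointSubspace.map_quotMap_mem_cone {a : Matrix (Fin ν) (Fin ν) T}
    (ha : a ∈ MatrixOrder.cone ν) : a.map J.quotMap ∈ MatrixOrder.cone ν :=
  map_quotMap_mem_cone_iff.2 fun ε hε => ⟨0, fun _ _ => J.toSubmodule.zero_mem, by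
    rw [add_zero]
    exact IsOperatorSystem.add_mem (scalarUnit_mem ν hε.le) ha⟩

theorem SelfAdjointSubspace.isUCP_quotMap (J : SelfAdjointSubspace T) : IsUCP J.quotMap where
  map_unit := rfl
  map_cone _ _ ha := map_quotMap_mem_cone ha

theorem SelfAdjointSubspace.isKernel (J : SelfAdjointSubspace T) [IsOperatorSystem J.Quotient] :
    IsKernel J :=
  ⟨J.Quotient, inferInstance, inferInstance, inferInstance, inferInstance, inferInstance,
    inferInstance, J.quotMap, J.isUCP_quotMap, J.ker_quotMap⟩

theorem isCompletelyOrderProximinal_of_exists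
    (h : ∀ (ν : ℕ) (a : Matrix (Fin ν) (Fin ν) T), a.map J.quotMap ∈ MatrixOrder.cone ν →
      ∃ b : Matrix (Fin ν) (Fin ν) T, (∀ i j, b i j ∈ J.toSubmodule) ∧
        a + b ∈ MatrixOrder.cone ν) : IsCompletelyOrderProximinal J := by
  refine fun ν a => ⟨h ν a, ?_⟩
  rintro ⟨b, hb, hab⟩
  rw [← SelfAdjointSubspace.map_add_quotMap hb]
  exact SelfAdjointSubspace.map_quotMap_mem_cone hab

/-- Proximinality removes the `ε` from the quotient cones, so that cone axioms can be checked on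
positive representatives. -/
theorem IsCompletelyOrderProximinal.mem_cone_iff (hJ : IsCompletelyOrderProximinal J)
    {x : Matrix (Fin ν) (Fin ν) J.Quotient} : x ∈ MatrixOrder.cone ν ↔
      ∃ c : Matrix (Fin ν) (Fin ν) T, c ∈ MatrixOrder.cone ν ∧ c.map J.quotMap = x := by
  constructor
  · intro hx
    obtain ⟨a, rfl⟩ := SelfAdjointSubspace.exists_map_quotMap_eq x
    obtain ⟨b, hb, hab⟩ := (hJ ν a).1 hx
    exact ⟨a + b, hab, SelfAdjointSubspace.map_add_quotMap hb⟩
  · rintro ⟨c, hc, rfl⟩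
    exact SelfAdjointSubspace.map_quotMap_mem_cone hc

/-- The quotient by an order proximinal subspace which is hereditary for the matrix order is an
operator system. -/
theorem IsCompletelyOrderProximinal.isOperatorSystem_quotient
    (hJ : IsCompletelyOrderProximinal J)
    (hered : ∀ (ν : ℕ) (a b : Matrix (Fin ν) (Fin ν) T), a ∈ MatrixOrder.cone ν →
      b ∈ MatrixOrder.cone ν → (∀ i j, (a + b) i j ∈ J.toSubmodule) →
        ∀ i j, a i j ∈ J.toSubmodule) : IsOperatorSystem J.Quotient where
  star_unit := congrArg J.quotMap IsOperatorSystem.star_unit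
  conjTranspose_eq hx := by
    obtain ⟨c, hc, rfl⟩ := hJ.mem_cone_iff.1 hx
    rw [← map_conjTranspose_of_map_star J.quotMap_star, IsOperatorSystem.conjTranspose_eq hc]
  zero_mem ν := hJ.mem_cone_iff.2 ⟨0, IsOperatorSystem.zero_mem ν, by ext i j; simp⟩
  add_mem hx hy := by
    obtain ⟨c, hc, rfl⟩ := hJ.mem_cone_iff.1 hx
    obtain ⟨d, hd, rfl⟩ := hJ.mem_cone_iff.1 hy
    exact hJ.mem_cone_iff.2 ⟨c + d, IsOperatorSystem.add_mem hc hd, matrix_map_add _ c d⟩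
  smul_mem {ν r x} hr hx := by
    obtain ⟨c, hc, rfl⟩ := hJ.mem_cone_iff.1 hx
    exact hJ.mem_cone_iff.2 ⟨(r : ℂ) • c, IsOperatorSystem.smul_mem hr hc, by ext i j; simp⟩
  proper {ν x} hx hy := by
    obtain ⟨c, hc, rfl⟩ := hJ.mem_cone_iff.1 hx
    obtain ⟨d, hd, hcd⟩ := hJ.mem_cone_iff.1 hy
    have h := hered ν c d hc hd fun i j => by
      rw [← SelfAdjointSubspace.quotMap_eq_zero, Matrix.add_apply, map_add]
      have := congrFun (congrFun hcd i) j
      simp only [Matrix.map_apply, Matrix.neg_apply] at this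
      rw [this, add_neg_cancel]
    ext i j
    exact SelfAdjointSubspace.quotMap_eq_zero.2 (h i j)
  conjBy_mem X x hx := by
    obtain ⟨c, hc, rfl⟩ := hJ.mem_cone_iff.1 hx
    exact hJ.mem_cone_iff.2 ⟨conjBy X c, IsOperatorSystem.conjBy_mem X hc, by
      ext i j; simp [conjBy]⟩
  order_unit {ν x} hx := by
    obtain ⟨a, rfl⟩ := SelfAdjointSubspace.exists_map_quotMap_eq x
    -- The representative `a` is hermitian only modulo `J`; its hermitian part has the same class.
    obtain ⟨r, hr, h⟩ := IsOperatorSystem.order_unit (hermPart_conjTranspose a)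
    refine ⟨r, hr, hJ.mem_cone_iff.2 ⟨_, h, ?_⟩⟩
    rw [matrix_map_add, map_scalarUnit_of_map_unit J.quotMap_unit, map_hermPart J.quotMap_star,
      hermPart_of_conjTranspose_eq hx]
  archimedean {ν x} h := by
    obtain ⟨a, rfl⟩ := SelfAdjointSubspace.exists_map_quotMap_eq x
    refine SelfAdjointSubspace.map_quotMap_mem_cone_iff.2 fun ε hε => ?_
    have := h ε hε
    rw [← map_scalarUnit_of_map_unit J.quotMap_unit, ← matrix_map_add] at this
    exact (hJ ν _).1 this

end Quotients

/-! ### Null-net corrections: proximinality and equality of the quotient norms. -/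

section NetSystems

variable {N : Type*} [Preorder N] [IsDirectedOrder N] [Nonempty N] {S : N → Type*}
  [∀ n, AddCommGroup (S n)] [∀ n, Module ℂ (S n)] [∀ n, StarAddMonoid (S n)]
  [∀ n, StarModule ℂ (S n)] [∀ n, MatrixOrder (S n)] [∀ n, IsOperatorSystem (S n)]
  {T : Type*} [AddCommGroup T] [Module ℂ T] [StarAddMonoid T] [StarModule ℂ T]
  [MatrixOrder T] [IsOperatorSystem T] {ν : ℕ}

/-- An operator system `T` of bounded nets, given by its coordinate maps `T → S_n`, which contains
all null nets, together with its subspace `J` of null nets. -/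
structure IsNetSystem (e : ∀ n, T →ₗ[ℂ] S n) (J : SelfAdjointSubspace T) : Prop where
  isUCP : ∀ n, IsUCP (e n)
  mem_cone : ∀ {ν : ℕ} {a : Matrix (Fin ν) (Fin ν) T},
    (∀ n, a.map (e n) ∈ MatrixOrder.cone ν) → a ∈ MatrixOrder.cone ν
  mem_iff : ∀ a : T, a ∈ J.toSubmodule ↔ Tendsto (fun n => ordNorm (e n a)) atTop (𝓝 0)
  exists_lift : ∀ f : ∀ n, S n, (∃ C : ℝ, ∀ n, ordNorm (f n) ≤ C) →
    Tendsto (fun n => ordNorm (f n)) atTop (𝓝 0) → ∃ a, ∀ n, e n a = f n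

theorem tendsto_matNorm_iff {a : ∀ n, Matrix (Fin ν) (Fin ν) (S n)} :
    Tendsto (fun n => matNorm (a n)) atTop (𝓝 0) ↔
      ∀ i j, Tendsto (fun n => ordNorm (a n i j)) atTop (𝓝 0) := by
  constructor
  · exact fun h i j => squeeze_zero (fun _ => ordNorm_nonneg _)
      (fun n => ordNorm_apply_le_matNorm (a n) i j) h
  · intro h
    have h' : Tendsto (fun n => (ν + ν : ℕ) * ∑ i, ∑ j, ordNorm (a n i j)) atTop (𝓝 0) := by
      simpa using (tendsto_finsetSum Finset.univ fun i _ =>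
        tendsto_finsetSum Finset.univ fun j _ => h i j).const_mul ((ν + ν : ℕ) : ℝ)
    refine squeeze_zero (fun _ => matNorm_nonneg _) (fun n => ?_) h'
    have h0 : ∀ i j, 0 ≤ ordNorm (a n i j) := fun i j => ordNorm_nonneg _
    refine matNorm_le_of_entries (Finset.sum_nonneg fun i _ => Finset.sum_nonneg fun j _ => h0 i j)
      fun i j => ?_
    exact (Finset.single_le_sum (f := fun j => ordNorm (a n i j)) (fun j _ => h0 i j)
      (Finset.mem_univ j)).trans (Finset.single_le_sum (f := fun i => ∑ j, ordNorm (a n i j))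
        (fun i _ => Finset.sum_nonneg fun j _ => h0 i j) (Finset.mem_univ i))

theorem tendsto_zero_iff_forall_eventually_le {f : N → ℝ} (h0 : ∀ n, 0 ≤ f n) :
    Tendsto f atTop (𝓝 0) ↔ ∀ ε : ℝ, 0 < ε → ∀ᶠ n in atTop, f n ≤ ε := by
  rw [Metric.tendsto_nhds]
  simp only [Real.dist_0_eq_abs, abs_of_nonneg (h0 _)]
  refine ⟨fun h ε hε => (h ε hε).mono fun n hn => hn.le, fun h ε hε => ?_⟩
  filter_upwards [h (ε / 2) (by positivity)] with n hn
  linarith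

namespace IsNetSystem

variable {e : ∀ n, T →ₗ[ℂ] S n} {J : SelfAdjointSubspace T} (he : IsNetSystem e J)
include he

theorem map_scalarUnit (n : N) (r : ℝ) :
    (scalarUnit ν r : Matrix (Fin ν) (Fin ν) T).map (e n) = scalarUnit ν r :=
  map_scalarUnit_of_map_unit (he.isUCP n).map_unit r

theorem forall_mem_iff_tendsto {b : Matrix (Fin ν) (Fin ν) T} :
    (∀ i j, b i j ∈ J.toSubmodule) ↔ Tendsto (fun n => matNorm (b.map (e n))) atTop (𝓝 0) := by
  rw [tendsto_matNorm_iff]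
  simp only [he.mem_iff, Matrix.map_apply]

theorem forall_mem_iff {b : Matrix (Fin ν) (Fin ν) T} :
    (∀ i j, b i j ∈ J.toSubmodule) ↔
      ∀ ε : ℝ, 0 < ε → ∀ᶠ n in atTop, matNorm (b.map (e n)) ≤ ε := by
  rw [he.forall_mem_iff_tendsto, tendsto_zero_iff_forall_eventually_le fun n => matNorm_nonneg _]

/-- The source of all corrections: a null net of matrices may be prescribed freely, coordinate by
coordinate. -/
theorem exists_matrix_lift (f : ∀ n, Matrix (Fin ν) (Fin ν) (S n))
    (hb : ∃ C : ℝ, ∀ n, matNorm (f n) ≤ C)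
    (hf : ∀ ε : ℝ, 0 < ε → ∀ᶠ n in atTop, matNorm (f n) ≤ ε) :
    ∃ b : Matrix (Fin ν) (Fin ν) T, (∀ i j, b i j ∈ J.toSubmodule) ∧ ∀ n, b.map (e n) = f n := by
  obtain ⟨C, hC⟩ := hb
  have ht := (tendsto_zero_iff_forall_eventually_le fun n => matNorm_nonneg _).2 hf
  choose b hb using fun i j => he.exists_lift (fun n => f n i j)
    ⟨C, fun n => (ordNorm_apply_le_matNorm (f n) i j).trans (hC n)⟩ (tendsto_matNorm_iff.1 ht i j)
  have hbf : ∀ n, (Matrix.of b).map (e n) = f n := fun n => by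
    ext i j
    exact hb i j n
  refine ⟨Matrix.of b, ?_, hbf⟩
  simpa only [he.forall_mem_iff, hbf] using hf

theorem matNorm_le_of_forall {a : Matrix (Fin ν) (Fin ν) T} {r : ℝ} (hr : 0 ≤ r)
    (h : ∀ n, matNorm (a.map (e n)) ≤ r) : matNorm a ≤ r := by
  refine matNorm_le hr (he.mem_cone fun n => ?_)
  rw [map_normBlock (he.isUCP n).map_unit (he.isUCP n).map_star]
  exact normBlock_mono (h n) (normBlock_matNorm_mem _)

/-- A hermitian net which is asymptotically positive is positive up to a null net. -/
theorem exists_add_mem_cone_of_hermitian {a : Matrix (Fin ν) (Fin ν) T} (ha : a.conjTranspose = a)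
    (h : ∀ ε : ℝ, 0 < ε → ∀ᶠ n in atTop, scalarUnit ν ε + a.map (e n) ∈ MatrixOrder.cone ν) :
    ∃ b : Matrix (Fin ν) (Fin ν) T, (∀ i j, b i j ∈ J.toSubmodule) ∧
      a + b ∈ MatrixOrder.cone ν := by
  have han : ∀ n, (a.map (e n)).conjTranspose = a.map (e n) := fun n => by
    rw [← map_conjTranspose_of_map_star (he.isUCP n).map_star, ha]
  -- The correction adds to each `a_n` the smallest multiple of the unit that makes it positive.
  -- These multiples are bounded by `‖a‖`, because `a_n ≥ -‖a_n‖ 1`, and tend to `0` by asymptotic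
  -- positivity.
  obtain ⟨b, hb, hbn⟩ := he.exists_matrix_lift
    (fun n => scalarUnit ν (negBound (a.map (e n))))
    ⟨matNorm a, fun n => (matNorm_scalarUnit_le (negBound_nonneg _)).trans <|
      (negBound_le (matNorm_nonneg _) (scalarUnit_add_mem_of_matNorm_le (han n) le_rfl)).trans
        ((he.isUCP n).matNorm_map_le a)⟩
    (fun ε hε => (h ε hε).mono fun n hn =>
      (matNorm_scalarUnit_le (negBound_nonneg _)).trans (negBound_le hε.le hn))
  refine ⟨b, hb, he.mem_cone fun n => ?_⟩
  rw [matrix_map_add, hbn, add_comm]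
  exact scalarUnit_negBound_add_mem (han n)

/-- The skew part `(a - a*) / 2` lies in `J` and is subtracted along with the correction, which
leaves the hermitian case. -/
theorem exists_add_mem_cone {a : Matrix (Fin ν) (Fin ν) T}
    (ha : ∀ i j, (a - a.conjTranspose) i j ∈ J.toSubmodule)
    (h : ∀ ε : ℝ, 0 < ε → ∀ᶠ n in atTop,
      scalarUnit ν ε + (hermPart a).map (e n) ∈ MatrixOrder.cone ν) :
    ∃ b : Matrix (Fin ν) (Fin ν) T, (∀ i j, b i j ∈ J.toSubmodule) ∧
      a + b ∈ MatrixOrder.cone ν := by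
  obtain ⟨b, hb, hab⟩ := he.exists_add_mem_cone_of_hermitian (hermPart_conjTranspose a) h
  refine ⟨b - (a - hermPart a), fun i j => J.toSubmodule.sub_mem (hb i j) ?_, ?_⟩
  · rw [sub_hermPart]
    exact J.toSubmodule.smul_mem _ (ha i j)
  · convert hab using 1
    abel

theorem isCompletelyOrderProximinal : IsCompletelyOrderProximinal J := by
  refine isCompletelyOrderProximinal_of_exists fun ν a ha => ?_
  rw [SelfAdjointSubspace.map_quotMap_mem_cone_iff] at ha
  refine he.exists_add_mem_cone (fun i j => ?_) fun ε hε => ?_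
  -- Any single `ε` suffices here: hermiticity of `ε + a + b` forces `a - a* = b* - b`.
  · obtain ⟨b, hb, hab⟩ := ha 1 one_pos
    have h := IsOperatorSystem.conjTranspose_eq hab
    rw [Matrix.conjTranspose_add, Matrix.conjTranspose_add, scalarUnit_conjTranspose] at h
    have h' : a - a.conjTranspose = b.conjTranspose - b := by
      rw [sub_eq_sub_iff_add_eq_add]
      rw [add_assoc, add_assoc, add_right_inj] at h
      rw [← h, add_comm]
    rw [h']
    exact J.toSubmodule.sub_mem (J.star_mem' (hb j i)) (hb i j)
  · obtain ⟨b, hb, hab⟩ := ha (ε / 2) (by positivity)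
    filter_upwards [he.forall_mem_iff.1 hb (ε / 2) (by positivity)] with n hn
    have hab' := (he.isUCP n).map_cone _ _ hab
    -- Neither `a` nor `b` need be hermitian, but their sum with the unit is, so it equals the sum
    -- of the hermitian parts. The hermitian part of `b_n` is eventually at most `ε / 2`, and the
    -- other `ε / 2` is already present.
    rw [← hermPart_of_conjTranspose_eq (IsOperatorSystem.conjTranspose_eq hab'),
      matrix_map_add, matrix_map_add, he.map_scalarUnit, hermPart_add, hermPart_add,
      hermPart_of_conjTranspose_eq (scalarUnit_conjTranspose _)] at hab'
    have h := IsOperatorSystem.add_mem hab' (scalarUnit_sub_mem_of_matNorm_le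
      (hermPart_conjTranspose _) ((matNorm_hermPart_le _).trans hn))
    rw [map_hermPart (he.isUCP n).map_star]
    convert h using 1
    nth_rewrite 1 [← add_halves ε]
    rw [scalarUnit_add]
    abel

theorem isOperatorSystem_quotient : IsOperatorSystem J.Quotient := by
  refine he.isCompletelyOrderProximinal.isOperatorSystem_quotient fun ν a b ha hb hab => ?_
  rw [he.forall_mem_iff] at hab ⊢
  intro ε hε
  filter_upwards [hab ε hε] with n hn
  rw [matrix_map_add] at hn
  exact (matNorm_le_matNorm_add ((he.isUCP n).map_cone _ _ ha)
    ((he.isUCP n).map_cone _ _ hb)).trans hn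

/-- Radial truncation to the ball of radius `r`: the `n`-th coordinate moves by at most `max (‖a_n‖
- r, 0)`, which tends to `0`. -/
theorem exists_matNorm_add_le {a : Matrix (Fin ν) (Fin ν) T} {r : ℝ} (hr : 0 ≤ r)
    (h : ∀ ε : ℝ, 0 < ε → ∀ᶠ n in atTop, matNorm (a.map (e n)) ≤ r + ε) :
    ∃ b : Matrix (Fin ν) (Fin ν) T, (∀ i j, b i j ∈ J.toSubmodule) ∧ matNorm (a + b) ≤ r := by
  let c : N → ℝ := fun n => if matNorm (a.map (e n)) ≤ r then 1 else r / matNorm (a.map (e n))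
  have hc0 : ∀ n, 0 ≤ c n := fun n => by
    by_cases hn : matNorm (a.map (e n)) ≤ r
    · simp [c, hn]
    · simp only [c, hn, if_false]
      exact div_nonneg hr (matNorm_nonneg _)
  have hc1 : ∀ n, c n ≤ 1 := fun n => by
    by_cases hn : matNorm (a.map (e n)) ≤ r
    · simp [c, hn]
    · simp only [c, hn, if_false]
      exact div_le_one_of_le₀ (not_le.1 hn).le (matNorm_nonneg _)
  have hcr : ∀ n, c n * matNorm (a.map (e n)) ≤ r := fun n => by
    by_cases hn : matNorm (a.map (e n)) ≤ r
    · simp [c, hn]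
    · simp only [c, hn, if_false]
      exact (div_mul_cancel₀ _ (hr.trans_lt (not_le.1 hn)).ne').le
  have hf : ∀ n, matNorm (-(((1 - c n : ℝ) : ℂ) • a.map (e n))) ≤
      (1 - c n) * matNorm (a.map (e n)) := fun n =>
    (matNorm_neg_le _).trans (matNorm_smul_le_of_nonneg (sub_nonneg.2 (hc1 n)) _)
  obtain ⟨b, hb, hbn⟩ := he.exists_matrix_lift (fun n => -(((1 - c n : ℝ) : ℂ) • a.map (e n)))
    ⟨matNorm a, fun n => by
      refine (hf n).trans (le_trans ?_ ((he.isUCP n).matNorm_map_le a))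
      exact mul_le_of_le_one_left (matNorm_nonneg _) (by linarith [hc0 n])⟩
    (fun ε hε => (h ε hε).mono fun n hn => by
      refine (hf n).trans ?_
      by_cases hnr : matNorm (a.map (e n)) ≤ r
      · simpa [c, hnr] using hε.le
      · have : c n * matNorm (a.map (e n)) = r := by
          simp only [c, hnr, if_false]
          exact div_mul_cancel₀ _ (hr.trans_lt (not_le.1 hnr)).ne'
        rw [sub_mul, this]
        linarith)
  refine ⟨b, hb, he.matNorm_le_of_forall hr fun n => ?_⟩
  have : (a + b).map (e n) = (c n : ℂ) • a.map (e n) := by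
    rw [matrix_map_add, hbn]
    push_cast
    module
  rw [this]
  exact (matNorm_smul_le_of_nonneg (hc0 n) _).trans (hcr n)

/-- Norms reduce to order: the norm block of the class at its own norm is positive, so by order
proximinality at level `2ν` it lifts to a positive block after adding a null `b`. Once `b_n ≤ ε`,
the norm block of `a_n` with diagonal enlarged by `ε` is positive. -/
theorem eventually_matNorm_le (a : Matrix (Fin ν) (Fin ν) T) {ε : ℝ} (hε : 0 < ε) :
    ∀ᶠ n in atTop, matNorm (a.map (e n)) ≤ matNorm (a.map J.quotMap) + ε := by
  have := he.isOperatorSystem_quotient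
  have h := normBlock_matNorm_mem (a.map J.quotMap)
  rw [← map_normBlock J.quotMap_unit J.quotMap_star, he.isCompletelyOrderProximinal] at h
  obtain ⟨b, hb, hab⟩ := h
  -- Hermiticity of `b` is automatic, as both the norm block and its positive correction are
  -- hermitian; it is needed to turn the norm bound on `b_n` into an order bound.
  have hbh : b.conjTranspose = b := by
    have := IsOperatorSystem.conjTranspose_eq hab
    rwa [Matrix.conjTranspose_add, normBlock_conjTranspose, add_right_inj] at this
  filter_upwards [he.forall_mem_iff.1 hb ε hε] with n hn
  have hs := (he.isUCP n).map_star
  refine matNorm_le (add_nonneg (matNorm_nonneg _) hε.le) ?_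
  have h₁ := (he.isUCP n).map_cone _ _ hab
  rw [matrix_map_add, map_normBlock (he.isUCP n).map_unit hs] at h₁
  have h₂ := IsOperatorSystem.add_mem h₁ (scalarUnit_sub_mem_of_matNorm_le
    (by rw [← map_conjTranspose_of_map_star hs, hbh]) hn)
  rw [normBlock_eq] at h₂ ⊢
  rw [scalarUnit_add]
  convert h₂ using 1
  abel

theorem exists_matNorm_add_eq (a : Matrix (Fin ν) (Fin ν) T) :
    ∃ b : Matrix (Fin ν) (Fin ν) T, (∀ i j, b i j ∈ J.toSubmodule) ∧
      matNorm (a + b) = matNorm (a.map J.quotMap) := by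
  have := he.isOperatorSystem_quotient
  obtain ⟨b, hb, hab⟩ := he.exists_matNorm_add_le (matNorm_nonneg (a.map J.quotMap))
    fun ε hε => he.eventually_matNorm_le a hε
  refine ⟨b, hb, hab.antisymm ?_⟩
  rw [← SelfAdjointSubspace.map_add_quotMap hb]
  exact J.isUCP_quotMap.matNorm_map_le _

/-- The order norm of the class is a lower bound for the norms of representatives, since the
quotient map is contractive, and truncation attains it. -/
theorem quotientsCompletelyIsometric : QuotientsCompletelyIsometric J := by
  have := he.isOperatorSystem_quotient
  intro ν x
  obtain ⟨a, rfl⟩ := SelfAdjointSubspace.exists_map_quotMap_eq x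
  obtain ⟨b, hb, hab⟩ := he.exists_matNorm_add_eq a
  refine IsLeast.csInf_eq ⟨⟨a + b, SelfAdjointSubspace.map_add_quotMap hb, hab⟩, ?_⟩
  rintro _ ⟨c, hc, rfl⟩
  rw [← hc]
  exact J.isUCP_quotMap.matNorm_map_le c

theorem isCompletelyBiproximinalKernel : IsCompletelyBiproximinalKernel J where
  isKernel :=
    have := he.isOperatorSystem_quotient
    J.isKernel
  orderProximinal := he.isCompletelyOrderProximinal
  normProximinal ν a := by
    rw [he.quotientsCompletelyIsometric]
    exact he.exists_matNorm_add_eq a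

end IsNetSystem

theorem Nets.isUCP_eval (n : N) : IsUCP (Nets.eval (S := S) n) where
  map_unit := rfl
  map_cone _ _ ha := ha n

theorem isNetSystem_nets : IsNetSystem (Nets.eval (S := S)) (nullNets S) where
  isUCP := Nets.isUCP_eval
  mem_cone h := h
  mem_iff _ := Iff.rfl
  exists_lift f hf _ := ⟨⟨f, hf⟩, fun _ => rfl⟩

/-- Contractivity of the connecting maps gives `‖a_n - j_{nm} a_m‖ ≤ ‖a_n‖ + ‖a_m‖`. Consequently
corrections by null nets never leave the `j`-convergent nets. -/
theorem SoftInductiveSystem.mem_convNets_of_tendsto (j : SoftInductiveSystem S) {a : Nets S}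
    (ha : Tendsto (fun n => ordNorm (Nets.eval n a)) atTop (𝓝 0)) :
    a ∈ j.convNets.toSubmodule := by
  refine (j.isConvergent_iff a).2 fun ε hε => ?_
  rw [tendsto_zero_iff_forall_eventually_le fun n => ordNorm_nonneg _] at ha
  have h := ha (ε / 2) (by positivity)
  filter_upwards [h] with m hm
  filter_upwards [h] with n hn
  have h₁ := ordNorm_sub_le (Nets.eval n a) (j.conn n m (Nets.eval m a))
  have h₂ := j.ordNorm_conn_le n m (Nets.eval m a)
  linarith

theorem SoftInductiveSystem.isNetSystem_convNets (j : SoftInductiveSystem S) :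
    IsNetSystem (fun n => Nets.eval n ∘ₗ j.convNets.incl) j.nullConvNets where
  isUCP n := ⟨rfl, fun _ _ ha => ha n⟩
  mem_cone h := h
  mem_iff _ := Iff.rfl
  exists_lift f hf h := ⟨⟨⟨f, hf⟩, j.mem_convNets_of_tendsto (a := ⟨f, hf⟩) h⟩, fun _ => rfl⟩

end NetSystems

/-! ### The limit space inside the quotient of all bounded nets, and its matrix levels. -/

section Limits

variable {N : Type*} [Preorder N] [IsDirectedOrder N] [Nonempty N] {S : N → Type*}
  [∀ n, AddCommGroup (S n)] [∀ n, Module ℂ (S n)] [∀ n, StarAddMonoid (S n)]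
  [∀ n, StarModule ℂ (S n)] [∀ n, MatrixOrder (S n)] [∀ n, IsOperatorSystem (S n)]
  (j : SoftInductiveSystem S) {ν : ℕ}

theorem SoftInductiveSystem.limitInclusion_quotMap (a : j.convNets.Elem) :
    j.limitInclusion (j.nullConvNets.quotMap a) = (nullNets S).quotMap (j.convNets.incl a) := rfl

theorem SoftInductiveSystem.limitInclusion_injective : Function.Injective j.limitInclusion := by
  rw [← LinearMap.ker_eq_bot, LinearMap.ker_eq_bot']
  intro x hx
  obtain ⟨a, rfl⟩ := j.nullConvNets.quotMap_surjective x
  rw [j.limitInclusion_quotMap, SelfAdjointSubspace.quotMap_eq_zero] at hx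
  exact SelfAdjointSubspace.quotMap_eq_zero.2 hx

theorem SoftInductiveSystem.isCompleteOrderEmbedding_limitInclusion :
    IsCompleteOrderEmbedding j.limitInclusion where
  injective := j.limitInclusion_injective
  map_unit := rfl
  map_star x := by
    obtain ⟨a, rfl⟩ := j.nullConvNets.quotMap_surjective x
    rfl
  mem_cone_iff ν x := by
    obtain ⟨a, rfl⟩ := SelfAdjointSubspace.exists_map_quotMap_eq x
    have h : (a.map j.nullConvNets.quotMap).map j.limitInclusion =
        (a.map j.convNets.incl).map (nullNets S).quotMap := rfl
    rw [h, j.isNetSystem_convNets.isCompletelyOrderProximinal,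
      isNetSystem_nets.isCompletelyOrderProximinal]
    constructor
    · rintro ⟨b, hb, hab⟩
      exact ⟨b.map j.convNets.incl, hb, hab⟩
    -- A correction found among all bounded nets is null, hence already `j`-convergent.
    · rintro ⟨b, hb, hab⟩
      exact ⟨Matrix.of fun p q => ⟨b p q, j.mem_convNets_of_tendsto (hb p q)⟩, hb, hab⟩

theorem SoftInductiveSystem.range_limitInclusion :
    LinearMap.range j.limitInclusion = j.convNets.toSubmodule.map (nullNets S).quotMap := by
  ext x
  constructor
  · rintro ⟨y, rfl⟩
    obtain ⟨a, rfl⟩ := j.nullConvNets.quotMap_surjective y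
    exact ⟨j.convNets.incl a, a.2, rfl⟩
  · rintro ⟨a, ha, rfl⟩
    exact ⟨j.nullConvNets.quotMap ⟨a, ha⟩, rfl⟩

theorem SoftInductiveSystem.matNorm_map_conn_le (n m : N) (a : Matrix (Fin ν) (Fin ν) (S m)) :
    matNorm (a.map (j.conn n m)) ≤ matNorm a := by
  unfold SoftInductiveSystem.conn extendByZero
  split_ifs with h
  · exact (j.isUCP h).matNorm_map_le a
  · have : a.map (0 : S m →ₗ[ℂ] S n) = 0 := by ext; rfl
    rw [this, matNorm_zero]
    exact matNorm_nonneg a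

theorem SoftInductiveSystem.isMatConvergent_iff (a : ∀ n, Matrix (Fin ν) (Fin ν) (S n)) :
    j.IsMatConvergent a ↔ (∃ C : ℝ, ∀ n, matNorm (a n) ≤ C) ∧
      ∀ ε : ℝ, 0 < ε → ∀ᶠ m in atTop, ∀ᶠ n in atTop,
        matNorm (a n - (a m).map (j.conn n m)) ≤ ε := by
  refine and_congr_right fun ⟨C, hC⟩ => tendsto_limsup_iff (C := C + C)
    (fun m n => matNorm_nonneg _) fun m n =>
      (matNorm_sub_le _ _).trans (add_le_add (hC n) ((j.matNorm_map_conn_le n m _).trans (hC m)))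

theorem SoftInductiveSystem.isMatConvergent_iff_exists
    (a : ∀ n, Matrix (Fin ν) (Fin ν) (S n)) : j.IsMatConvergent a ↔
      ∃ c : Matrix (Fin ν) (Fin ν) j.convNets.Elem,
        ∀ n, (c.map j.convNets.incl).map (Nets.eval n) = a n := by
  rw [j.isMatConvergent_iff]
  constructor
  · rintro ⟨⟨C, hC⟩, h⟩
    let b (p q : Fin ν) : Nets S :=
      ⟨fun n => a n p q, C, fun n => (ordNorm_apply_le_matNorm (a n) p q).trans (hC n)⟩
    have hb : ∀ p q, b p q ∈ j.convNets.toSubmodule := fun p q => by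
      refine (j.isConvergent_iff _).2 fun ε hε => ?_
      filter_upwards [h ε hε] with m hm
      filter_upwards [hm] with n hn
      exact (ordNorm_apply_le_matNorm (a n - (a m).map (j.conn n m)) p q).trans hn
    exact ⟨Matrix.of fun p q => ⟨b p q, hb p q⟩, fun n => rfl⟩
  · rintro ⟨c, hc⟩
    refine ⟨⟨matNorm c, fun n => ?_⟩, fun ε hε => ?_⟩
    · rw [← hc]
      exact (j.isNetSystem_convNets.isUCP n).matNorm_map_le c
    · have h : ∀ᶠ m in atTop, ∀ p q, ∀ᶠ n in atTop,
          -- Passing from entries to the matrix norm costs a factor `2ν`; the extra `1` keeps the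
          -- denominator positive when `ν = 0`.
          ordNorm (a n p q - j.conn n m (a m p q)) ≤ ε / ((ν + ν : ℕ) + 1) := by
        simp only [eventually_all]
        intro p q
        simp only [← hc]
        exact (j.isConvergent_iff _).1 (c p q).2 _ (by positivity)
      filter_upwards [h] with m hm
      simp only [← eventually_all] at hm
      filter_upwards [hm] with n hn
      refine (matNorm_le_of_entries (by positivity) hn).trans ?_
      rw [mul_div_assoc', div_le_iff₀ (by positivity)]
      nlinarith

theorem SoftInductiveSystem.mem_cone_limit_iff (x : Matrix (Fin ν) (Fin ν) j.Limit) :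
    x ∈ MatrixOrder.cone ν ↔ ∃ c : Matrix (Fin ν) (Fin ν) j.convNets.Elem,
      (∀ n, (c.map j.convNets.incl).map (Nets.eval n) ∈ MatrixOrder.cone ν) ∧
        c.map j.nullConvNets.quotMap = x :=
  j.isNetSystem_convNets.isCompletelyOrderProximinal.mem_cone_iff

end Limits

/-! ### Matrix cones of C*-algebras and norm estimates for complete order embeddings. -/

section CStarCones

variable {A : Type*} [CStarAlgebra A] {ν : ℕ}

theorem cstar_nonneg_iff_eq_star_mul_self [PartialOrder A] [StarOrderedRing A] {a : A} :
    0 ≤ a ↔ ∃ y : A, a = star y * y :=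
  CStarAlgebra.nonneg_iff_eq_star_mul_self

/-- A description of the cone free of the local spectral order, which can be transported through
products and quotients. -/
theorem cstar_mem_cone_iff {a : Matrix (Fin ν) (Fin ν) A} :
    a ∈ MatrixOrder.cone ν ↔ ∃ y : Matrix (Fin ν) (Fin ν) A, a = y.conjTranspose * y := by
  let _ := CStarAlgebra.spectralOrder A
  let _ := CStarAlgebra.spectralOrderedRing A
  change 0 ≤ (CStarMatrix.ofMatrix a : CStarMatrix (Fin ν) (Fin ν) A) ↔ _
  exact cstar_nonneg_iff_eq_star_mul_self (A := CStarMatrix (Fin ν) (Fin ν) A)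

theorem cstar_add_mem_cone {a b : Matrix (Fin ν) (Fin ν) A} (ha : a ∈ MatrixOrder.cone ν)
    (hb : b ∈ MatrixOrder.cone ν) : a + b ∈ MatrixOrder.cone ν := by
  let _ := CStarAlgebra.spectralOrder A
  let _ := CStarAlgebra.spectralOrderedRing A
  exact add_nonneg (α := CStarMatrix (Fin ν) (Fin ν) A) ha hb

theorem cstar_mem_cone_one_iff [PartialOrder A] [StarOrderedRing A] {a : A} :
    (Matrix.of fun _ _ : Fin 1 => a) ∈ MatrixOrder.cone 1 ↔ 0 ≤ a := by
  rw [cstar_mem_cone_iff, CStarAlgebra.nonneg_iff_eq_star_mul_self]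
  constructor
  · rintro ⟨y, hy⟩
    exact ⟨y 0 0, by simpa [Matrix.mul_apply] using congrFun (congrFun hy 0) 0⟩
  · rintro ⟨y, rfl⟩
    refine ⟨Matrix.of fun _ _ => y, ?_⟩
    ext i j
    simp [Matrix.mul_apply]

/-- For self-adjoint `a`, one of `±‖a‖` belongs to the spectrum, so order bounds by `±r` bound the
norm. In the zero algebra the spectrum is empty, whence the separate case. -/
theorem norm_le_iff_add_nonneg_and_sub_nonneg [PartialOrder A] [StarOrderedRing A] {a : A}
    (ha : IsSelfAdjoint a) {r : ℝ} (hr : 0 ≤ r) :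
    ‖a‖ ≤ r ↔ 0 ≤ (r : ℂ) • (1 : A) + a ∧ 0 ≤ (r : ℂ) • (1 : A) - a := by
  have hrA : (r : ℂ) • (1 : A) = algebraMap ℝ A r := by
    rw [Algebra.algebraMap_eq_smul_one, Complex.coe_smul]
  rw [hrA]
  have hmono : ‖a‖ ≤ r → algebraMap ℝ A ‖a‖ ≤ algebraMap ℝ A r := fun h =>
    algebraMap_mono A h
  constructor
  · intro h
    refine ⟨?_, sub_nonneg.2 (ha.le_algebraMap_norm_self.trans (hmono h))⟩
    rw [← neg_le_iff_add_nonneg']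
    exact (neg_le_neg (hmono h)).trans ha.neg_algebraMap_norm_le_self
  · rintro ⟨h₁, h₂⟩
    rcases subsingleton_or_nontrivial A with h | h
    · simpa [Subsingleton.elim a 0] using hr
    rcases CStarAlgebra.norm_or_neg_norm_mem_spectrum ha with hm | hm
    · exact (le_algebraMap_iff_spectrum_le (R := ℝ)).1 (sub_nonneg.1 h₂) _ hm
    · rw [← neg_le_iff_add_nonneg', ← map_neg] at h₁
      exact neg_le_neg_iff.1 ((algebraMap_le_iff_le_spectrum (R := ℝ)).1 h₁ _ hm)

theorem cstarMatrix_norm_le_sum [PartialOrder A] [StarOrderedRing A] {m : Type*} [Fintype m]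
    (M : CStarMatrix m m A) : ‖M‖ ≤ ∑ j, ∑ i, ‖M i j‖ := by
  rw [CStarMatrix.norm_def]
  refine (CStarMatrix.toCLM M).opNorm_le_bound
    (Finset.sum_nonneg fun _ _ => Finset.sum_nonneg fun _ _ => norm_nonneg _) fun v => ?_
  simp only [CStarMatrix.toCLM_apply_eq_sum, Finset.sum_mul]
  refine (WithCStarModule.pi_norm_le_sum_norm _).trans ?_
  gcongr with i _
  refine (norm_sum_le _ _).trans ?_
  gcongr with j _
  refine (norm_mul_le _ _).trans ?_
  rw [mul_comm]
  gcongr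
  exact WithCStarModule.norm_apply_le_norm v j

/-- A hermitian matrix over a C*-algebra is bounded below by the norms of its entries. -/
theorem cstar_scalarUnit_add_mem_cone {a : Matrix (Fin ν) (Fin ν) A} (ha : a.conjTranspose = a)
    {r : ℝ} (h : ∑ j, ∑ i, ‖a i j‖ ≤ r) : scalarUnit ν r + a ∈ MatrixOrder.cone ν := by
  let _ := CStarAlgebra.spectralOrder A
  let _ := CStarAlgebra.spectralOrderedRing A
  have hr : 0 ≤ r :=
    (Finset.sum_nonneg fun _ _ => Finset.sum_nonneg fun _ _ => norm_nonneg _).trans h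
  have h₁ := ((norm_le_iff_add_nonneg_and_sub_nonneg (A := CStarMatrix (Fin ν) (Fin ν) A)
    (a := CStarMatrix.ofMatrix a) ha hr).1 ((cstarMatrix_norm_le_sum _).trans h)).1
  change 0 ≤ CStarMatrix.ofMatrix (scalarUnit ν r + a)
  convert h₁ using 1
  ext i k
  change scalarUnit ν r i k + a i k = ((r : ℂ) • (1 : CStarMatrix (Fin ν) (Fin ν) A)) i k + a i k
  rw [CStarMatrix.smul_apply, CStarMatrix.one_apply, scalarUnit, Matrix.diagonal_apply, smul_ite,
    smul_zero]
  rfl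

/-- The diagonal entry `a i i` is a sum of positive terms `star (y k i) * y k i` and dominates each
of them. This keeps the factors of a bounded positive net bounded. -/
theorem sq_norm_le_of_eq_conjTranspose_mul {a y : Matrix (Fin ν) (Fin ν) A}
    (h : a = y.conjTranspose * y) (k i : Fin ν) : ‖y k i‖ ^ 2 ≤ ‖a i i‖ := by
  let _ := CStarAlgebra.spectralOrder A
  let _ := CStarAlgebra.spectralOrderedRing A
  rw [sq, ← CStarRing.norm_star_mul_self]
  refine CStarAlgebra.norm_le_norm_of_nonneg_of_le (star_mul_self_nonneg _) ?_
  rw [h, Matrix.mul_apply]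
  exact Finset.single_le_sum (f := fun k => star (y k i) * y k i)
    (fun k _ => star_mul_self_nonneg _) (Finset.mem_univ k)

variable {S : Type*} [AddCommGroup S] [Module ℂ S] [StarAddMonoid S] [StarModule ℂ S]
  [MatrixOrder S] [IsOperatorSystem S] {ι : S →ₗ[ℂ] A}

/-- On hermitian elements both norms are determined by `-r ≤ a ≤ r`, a condition which the embedding
preserves and reflects. -/
theorem IsCompleteOrderEmbedding.norm_map_of_star_eq (hι : IsCompleteOrderEmbedding ι) {a : S}
    (ha : star a = a) : ‖ι a‖ = ordNorm a := by
  let _ := CStarAlgebra.spectralOrder A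
  let _ := CStarAlgebra.spectralOrderedRing A
  have hιa : IsSelfAdjoint (ι a) := by rw [IsSelfAdjoint, ← hι.map_star, ha]
  have ha' : (Matrix.of fun _ _ : Fin 1 => a).conjTranspose = Matrix.of fun _ _ => a := by
    ext i j
    simp [ha]
  have key : ∀ r : ℝ, 0 ≤ r → (‖ι a‖ ≤ r ↔ ordNorm a ≤ r) := fun r hr => by
    have h₁ : (scalarUnit 1 r + Matrix.of fun _ _ => a).map ι =
        Matrix.of fun _ _ => (r : ℂ) • (1 : A) + ι a := by
      ext i j
      simp [scalarUnit, Subsingleton.elim i j, hι.map_unit]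
      rfl
    have h₂ : (scalarUnit 1 r - Matrix.of fun _ _ => a).map ι =
        Matrix.of fun _ _ => (r : ℂ) • (1 : A) - ι a := by
      ext i j
      simp [scalarUnit, Subsingleton.elim i j, hι.map_unit]
      rfl
    rw [norm_le_iff_add_nonneg_and_sub_nonneg hιa hr, ← cstar_mem_cone_one_iff,
      ← cstar_mem_cone_one_iff, ← h₁, ← h₂, ← hι.mem_cone_iff, ← hι.mem_cone_iff, ← normBlock_mem_iff ha']
    exact ⟨matNorm_le hr, fun h => normBlock_mono h (normBlock_matNorm_mem _)⟩
  exact le_antisymm ((key _ (ordNorm_nonneg a)).2 le_rfl) ((key _ (norm_nonneg _)).1 le_rfl)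

theorem exists_star_eq_add_I_smul (a : S) : ∃ b c : S, star b = b ∧ star c = c ∧
    a = b + Complex.I • c ∧ b = (1 / 2 : ℂ) • (a + star a) ∧
      c = (-Complex.I / 2) • (a - star a) := by
  refine ⟨_, _, ?_, ?_, ?_, rfl, rfl⟩
  · simp [add_comm]
  · simp only [star_smul, star_sub, star_star]
    simp
    module
  · rw [smul_smul]
    have : Complex.I * (-Complex.I / 2) = 1 / 2 := by
      linear_combination (-1 / 2 : ℂ) * Complex.I_mul_I
    rw [this]
    module

/-- The isometry on hermitian elements is applied to the real and imaginary parts. The resulting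
factor `2` is harmless, since only boundedness and convergence to `0` are to be transferred. -/
theorem IsCompleteOrderEmbedding.norm_map_le (hι : IsCompleteOrderEmbedding ι) (a : S) :
    ‖ι a‖ ≤ 2 * ordNorm a := by
  obtain ⟨b, c, hb, hc, hbc, hb', hc'⟩ := exists_star_eq_add_I_smul a
  have h₁ : ordNorm b ≤ ordNorm a := by
    rw [hb']
    refine (ordNorm_smul_le _ _).trans ?_
    have := ordNorm_add_le a (star a)
    have := ordNorm_star_le a
    norm_num
    linarith
  have h₂ : ordNorm c ≤ ordNorm a := by
    rw [hc']
    refine (ordNorm_smul_le _ _).trans ?_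
    have := ordNorm_sub_le a (star a)
    have := ordNorm_star_le a
    norm_num
    linarith
  rw [hbc, map_add, map_smul]
  refine (norm_add_le _ _).trans ?_
  rw [norm_smul, Complex.norm_I, one_mul, hι.norm_map_of_star_eq hb, hι.norm_map_of_star_eq hc,
    ← hbc]
  linarith

theorem IsCompleteOrderEmbedding.ordNorm_le (hι : IsCompleteOrderEmbedding ι) (a : S) :
    ordNorm a ≤ 2 * ‖ι a‖ := by
  obtain ⟨b, c, hb, hc, hbc, hb', hc'⟩ := exists_star_eq_add_I_smul a
  have h₁ : ‖ι b‖ ≤ ‖ι a‖ := by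
    rw [hb', map_smul, map_add, hι.map_star, norm_smul]
    have := norm_add_le (ι a) (star (ι a))
    rw [norm_star] at this
    norm_num
    linarith
  have h₂ : ‖ι c‖ ≤ ‖ι a‖ := by
    rw [hc', map_smul, map_sub, hι.map_star, norm_smul]
    have := norm_sub_le (ι a) (star (ι a))
    rw [norm_star] at this
    norm_num
    linarith
  have h₃ := ordNorm_add_le b (Complex.I • c)
  have h₄ := ordNorm_smul_le Complex.I c
  rw [Complex.norm_I, one_mul] at h₄
  rw [← hbc] at h₃
  rw [hι.norm_map_of_star_eq hb] at h₁
  rw [hι.norm_map_of_star_eq hc] at h₂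
  linarith

end CStarCones

/-! ### The induced embedding into the quotient of the product C*-algebra. -/

section Representations

variable {N : Type*} {S : N → Type*}
  [∀ n, AddCommGroup (S n)] [∀ n, Module ℂ (S n)] [∀ n, StarAddMonoid (S n)]
  [∀ n, StarModule ℂ (S n)] [∀ n, MatrixOrder (S n)] [∀ n, IsOperatorSystem (S n)]
  {A : N → Type*} [∀ n, CStarAlgebra (A n)] {ι : ∀ n, S n →ₗ[ℂ] A n} {ν : ℕ}

theorem memℓp_rep (hι : ∀ n, IsCompleteOrderEmbedding (ι n)) (a : Nets S) :
    Memℓp (fun n => ι n (Nets.eval n a)) ∞ := by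
  obtain ⟨C, hC⟩ := a.2
  refine memℓp_infty ⟨2 * C, ?_⟩
  rintro _ ⟨n, rfl⟩
  exact ((hι n).norm_map_le _).trans (mul_le_mul_of_nonneg_left (hC n) zero_le_two)

/-- The map `∏_n S_n → ∏_n A_n` induced by unital complete order embeddings `S_n → A_n`. -/
noncomputable def netsRep (hι : ∀ n, IsCompleteOrderEmbedding (ι n)) :
    Nets S →ₗ[ℂ] lp A ∞ where
  toFun a := ⟨fun n => ι n (Nets.eval n a), memℓp_rep hι a⟩
  map_add' a b := lp.ext (funext fun n => map_add (ι n ∘ₗ Nets.eval n) a b)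
  map_smul' c a := lp.ext (funext fun n => map_smul (ι n ∘ₗ Nets.eval n) c a)

theorem netsRep_star (hι : ∀ n, IsCompleteOrderEmbedding (ι n)) (a : Nets S) :
    netsRep hι (star a) = star (netsRep hι a) :=
  lp.ext (funext fun n => (hι n).map_star (Nets.eval n a))

theorem lp_conjTranspose_mul_apply (Y : Matrix (Fin ν) (Fin ν) (lp A ∞)) (i k : Fin ν) (n : N) :
    (∑ l, star (Y l i) * Y l k : lp A ∞) n =
      ((Y.map fun f => f n).conjTranspose * Y.map fun f => f n) i k := by
  rw [lp.coeFn_sum, Finset.sum_apply, Matrix.mul_apply]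
  rfl

variable [Preorder N] [IsDirectedOrder N] [Nonempty N]

/-- One direction makes the induced map well defined, the other makes it injective. -/
theorem netsRep_mem_cstarNull_iff (hι : ∀ n, IsCompleteOrderEmbedding (ι n)) (a : Nets S) :
    netsRep hι a ∈ cstarNull A ↔ a ∈ (nullNets S).toSubmodule := by
  constructor
  · intro h
    have h' := Tendsto.const_mul 2 h
    rw [mul_zero] at h'
    exact squeeze_zero (fun _ => ordNorm_nonneg _) (fun n => (hι n).ordNorm_le _) h'
  · intro h
    have h' := Tendsto.const_mul 2 h
    rw [mul_zero] at h'
    exact squeeze_zero (fun _ => norm_nonneg _) (fun n => (hι n).norm_map_le _) h'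

/-- The map `∏_n S_n / C_0 → ∏_n A_n / ⊕_n A_n` induced by unital complete order embeddings
`S_n → A_n`. -/
noncomputable def quotientRep (hι : ∀ n, IsCompleteOrderEmbedding (ι n)) :
    NetsQuotient S →ₗ[ℂ] CStarQuotient A :=
  Submodule.mapQ (nullNets S).toSubmodule (cstarNull A) (netsRep hι)
    fun a ha => (netsRep_mem_cstarNull_iff hι a).2 ha

theorem quotientRep_quotMap (hι : ∀ n, IsCompleteOrderEmbedding (ι n)) (a : Nets S) :
    quotientRep hι ((nullNets S).quotMap a) = CStarQuotient.mk (netsRep hι a) := rfl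

theorem quotientRep_injective (hι : ∀ n, IsCompleteOrderEmbedding (ι n)) :
    Function.Injective (quotientRep hι) := by
  rw [← LinearMap.ker_eq_bot, LinearMap.ker_eq_bot']
  intro x hx
  obtain ⟨a, rfl⟩ := (nullNets S).quotMap_surjective x
  rw [quotientRep_quotMap, ← map_zero CStarQuotient.mk, CStarQuotient.mk_eq_mk, sub_zero,
    netsRep_mem_cstarNull_iff] at hx
  exact SelfAdjointSubspace.quotMap_eq_zero.2 hx

theorem CStarQuotient.map_mk_conjTranspose_mul (Y : Matrix (Fin ν) (Fin ν) (lp A ∞)) :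
    (Y.map (CStarQuotient.mk (A := A))).conjTranspose * Y.map CStarQuotient.mk =
      Matrix.of fun i k => CStarQuotient.mk (∑ l, star (Y l i) * Y l k) := by
  ext i k
  rw [Matrix.mul_apply, Matrix.of_apply, map_sum]
  rfl

theorem CStarQuotient.mem_cone_iff {a : Matrix (Fin ν) (Fin ν) (CStarQuotient A)} :
    a ∈ MatrixOrder.cone ν ↔ ∃ Y : Matrix (Fin ν) (Fin ν) (lp A ∞),
      a = Matrix.of fun i k => CStarQuotient.mk (∑ l, star (Y l i) * Y l k) := by
  rw [cstar_mem_cone_iff]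
  constructor
  · rintro ⟨y, rfl⟩
    choose f hf using CStarQuotient.mk_surjective (A := A)
    obtain ⟨Y, rfl⟩ : ∃ Y : Matrix (Fin ν) (Fin ν) (lp A ∞), Y.map CStarQuotient.mk = y :=
      ⟨y.map f, by ext i k; exact hf _⟩
    exact ⟨Y, CStarQuotient.map_mk_conjTranspose_mul Y⟩
  · rintro ⟨Y, rfl⟩
    exact ⟨Y.map CStarQuotient.mk, (CStarQuotient.map_mk_conjTranspose_mul Y).symm⟩

/-- Coordinatewise factorisations `y_n* y_n` assemble into a factorisation over the bounded nets,
which then passes to the quotient. -/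
theorem quotientRep_map_mem_cone (hι : ∀ n, IsCompleteOrderEmbedding (ι n))
    {a : Matrix (Fin ν) (Fin ν) (Nets S)} (ha : a ∈ MatrixOrder.cone ν) :
    (a.map (nullNets S).quotMap).map (quotientRep hι) ∈ MatrixOrder.cone ν := by
  choose y hy using fun n => cstar_mem_cone_iff.1 (((hι n).mem_cone_iff _ _).1 (ha n))
  have hbd : ∀ l i, Memℓp (fun n => y n l i) ∞ := fun l i => by
    refine memℓp_infty ⟨√‖netsRep hι (a i i)‖, ?_⟩
    rintro _ ⟨n, rfl⟩
    refine Real.le_sqrt_of_sq_le ((sq_norm_le_of_eq_conjTranspose_mul (hy n) l i).trans ?_)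
    exact lp.norm_apply_le_norm ENNReal.top_ne_zero (netsRep hι (a i i)) n
  let Y : Matrix (Fin ν) (Fin ν) (lp A ∞) := Matrix.of fun l i => ⟨fun n => y n l i, hbd l i⟩
  refine CStarQuotient.mem_cone_iff.2 ⟨Y, ?_⟩
  ext i k
  refine congrArg CStarQuotient.mk (lp.ext (funext fun n => ?_))
  rw [lp_conjTranspose_mul_apply]
  exact congrFun (congrFun (hy n) i) k

/-- Positivity in the quotient yields `ι(a) = P + Z` with `P = Y* Y` and `Z` null. Hence the
hermitian part of `ι(a)` is `P + H` with `H` null and hermitian, and `a` is asymptotically positive.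
-/
theorem map_quotMap_mem_cone_of_quotientRep (hι : ∀ n, IsCompleteOrderEmbedding (ι n))
    {a : Matrix (Fin ν) (Fin ν) (Nets S)}
    (ha : (a.map (nullNets S).quotMap).map (quotientRep hι) ∈ MatrixOrder.cone ν) :
    a.map (nullNets S).quotMap ∈ MatrixOrder.cone ν := by
  obtain ⟨Y, hy⟩ := CStarQuotient.mem_cone_iff.1 ha
  let P : Matrix (Fin ν) (Fin ν) (lp A ∞) := Matrix.of fun i k => ∑ l, star (Y l i) * Y l k
  have hP : ∀ i k, star (P k i) = P i k := fun i k => by simp [P, star_sum]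
  let Z : Matrix (Fin ν) (Fin ν) (lp A ∞) := a.map (netsRep hι) - P
  have hZ : ∀ i k, Z i k ∈ cstarNull A := fun i k =>
    CStarQuotient.mk_eq_mk.1 (congrFun (congrFun hy i) k)
  let H : Matrix (Fin ν) (Fin ν) (lp A ∞) := Matrix.of fun i k =>
    (1 / 2 : ℂ) • (Z i k + star (Z k i))
  have hH : ∀ i k, H i k ∈ cstarNull A := fun i k =>
    (cstarNull A).smul_mem _ ((cstarNull A).add_mem (hZ i k) (cstarNull_star (hZ k i)))
  have hHs : ∀ i k, star (H k i) = H i k := fun i k => by simp [H, add_comm]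
  have hHP : ∀ i k, (1 / 2 : ℂ) • (netsRep hι (a i k) + star (netsRep hι (a k i))) =
      P i k + H i k := fun i k => by
    simp only [H, Z, Matrix.of_apply, Matrix.sub_apply, Matrix.map_apply, star_sub, hP]
    module
  refine (isNetSystem_nets.isCompletelyOrderProximinal ν a).2
    (isNetSystem_nets.exists_add_mem_cone (fun i k => ?_) fun ε hε => ?_)
  · rw [← netsRep_mem_cstarNull_iff hι]
    have h : netsRep hι ((a - a.conjTranspose) i k) = Z i k - star (Z k i) := by
      simp only [Z, Matrix.sub_apply, Matrix.map_apply, Matrix.conjTranspose_apply, map_sub,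
        netsRep_star, star_sub, hP]
      abel
    rw [h]
    exact (cstarNull A).sub_mem (hZ i k) (cstarNull_star (hZ k i))
  · have hsum : Tendsto (fun n => ∑ k, ∑ i, ‖H i k n‖) atTop (𝓝 0) := by
      simpa using tendsto_finsetSum Finset.univ fun k _ =>
        tendsto_finsetSum Finset.univ fun i _ => hH i k
    rw [tendsto_zero_iff_forall_eventually_le fun n =>
      Finset.sum_nonneg fun _ _ => Finset.sum_nonneg fun _ _ => norm_nonneg _] at hsum
    filter_upwards [hsum ε hε] with n hn
    have h₁ : scalarUnit ν ε + H.map (fun f => f n) ∈ MatrixOrder.cone ν :=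
      cstar_scalarUnit_add_mem_cone (by
        ext i k
        exact congrArg (fun f : lp A ∞ => f n) (hHs i k)) hn
    have h₂ : P.map (fun f => f n) ∈ MatrixOrder.cone ν := by
      refine cstar_mem_cone_iff.2 ⟨Y.map fun f => f n, ?_⟩
      ext i k
      exact lp_conjTranspose_mul_apply Y i k n
    -- Positivity of `ε + H_n + P_n` is proved in `A n` and reflected to `S n` by the embedding.
    refine ((hι n).mem_cone_iff _ _).2 ?_
    rw [matrix_map_add, map_scalarUnit_of_map_unit (hι n).map_unit]
    convert cstar_add_mem_cone h₁ h₂ using 1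
    rw [add_assoc, add_comm (H.map _)]
    congr 1
    rw [map_hermPart (Nets.isUCP_eval n).map_star, map_hermPart (hι n).map_star]
    ext i k
    exact congrArg (fun f : lp A ∞ => f n) (hHP i k)

theorem isCompleteOrderEmbedding_quotientRep (hι : ∀ n, IsCompleteOrderEmbedding (ι n)) :
    IsCompleteOrderEmbedding (quotientRep hι) where
  injective := quotientRep_injective hι
  map_unit := congrArg CStarQuotient.mk (lp.ext (funext fun n => (hι n).map_unit))
  map_star x := by
    obtain ⟨a, rfl⟩ := (nullNets S).quotMap_surjective x
    exact congrArg CStarQuotient.mk (netsRep_star hι a)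
  mem_cone_iff ν x := by
    constructor
    · intro hx
      obtain ⟨a, ha, rfl⟩ := isNetSystem_nets.isCompletelyOrderProximinal.mem_cone_iff.1 hx
      exact quotientRep_map_mem_cone hι ha
    · intro hx
      obtain ⟨a, rfl⟩ := SelfAdjointSubspace.exists_map_quotMap_eq x
      exact map_quotMap_mem_cone_of_quotientRep hι hx

end Representations

section Composition

variable {S T R : Type*} [AddCommGroup S] [Module ℂ S] [Star S] [MatrixOrder S]
  [AddCommGroup T] [Module ℂ T] [Star T] [MatrixOrder T]
  [AddCommGroup R] [Module ℂ R] [Star R] [MatrixOrder R]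

theorem IsCompleteOrderEmbedding.comp {ψ : T →ₗ[ℂ] R} {φ : S →ₗ[ℂ] T}
    (hψ : IsCompleteOrderEmbedding ψ) (hφ : IsCompleteOrderEmbedding φ) :
    IsCompleteOrderEmbedding (ψ ∘ₗ φ) where
  injective := hψ.injective.comp hφ.injective
  map_unit := (congrArg ψ hφ.map_unit).trans hψ.map_unit
  map_star a := (congrArg ψ (hφ.map_star a)).trans (hψ.map_star _)
  mem_cone_iff ν a := (hφ.mem_cone_iff ν a).trans (hψ.mem_cone_iff ν _)

end Composition

end SoftLimits

theorem mainTheorem4 {N : Type*} [Preorder N] [IsDirectedOrder N] [Nonempty N]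
    {S : N → Type*} [∀ n, AddCommGroup (S n)] [∀ n, Module ℂ (S n)] [∀ n, StarAddMonoid (S n)]
    [∀ n, StarModule ℂ (S n)] [∀ n, SoftLimits.MatrixOrder (S n)]
    [∀ n, SoftLimits.IsOperatorSystem (S n)] (j : SoftLimits.SoftInductiveSystem S) :
    -- the quotients by the null nets are operator systems
    SoftLimits.IsOperatorSystem j.Limit ∧
    SoftLimits.IsOperatorSystem (SoftLimits.NetsQuotient S) ∧
    -- operator space and operator system quotients are completely isometric
    SoftLimits.QuotientsCompletelyIsometric j.nullConvNets ∧
    SoftLimits.QuotientsCompletelyIsometric (SoftLimits.nullNets S) ∧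
    -- the null nets are a completely biproximinal kernel
    SoftLimits.IsCompletelyBiproximinalKernel j.nullConvNets ∧
    SoftLimits.IsCompletelyBiproximinalKernel (SoftLimits.nullNets S) ∧
    -- the limit is completely order embedded in the quotient of the bounded nets
    SoftLimits.IsCompleteOrderEmbedding j.limitInclusion ∧
    LinearMap.range j.limitInclusion =
      j.convNets.toSubmodule.map (SoftLimits.nullNets S).quotMap ∧
    -- for all concrete representations `S_n ⊆ A_n`, the induced maps into the C*-algebra
    -- `∏ A_n / ⊕ A_n` are well defined complete order embeddings
    (∀ (A : N → Type*) [∀ n, CStarAlgebra (A n)] (ι : ∀ n, S n →ₗ[ℂ] A n),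
      (∀ n, SoftLimits.IsCompleteOrderEmbedding (ι n)) →
      ∃ Θ : SoftLimits.NetsQuotient S →ₗ[ℂ] SoftLimits.CStarQuotient A,
        (∀ a : SoftLimits.Nets S, ∃ h : Memℓp (fun n => ι n (SoftLimits.Nets.eval n a)) ∞,
          Θ ((SoftLimits.nullNets S).quotMap a) =
            SoftLimits.CStarQuotient.mk ⟨fun n => ι n (SoftLimits.Nets.eval n a), h⟩) ∧
        SoftLimits.IsCompleteOrderEmbedding Θ ∧
        SoftLimits.IsCompleteOrderEmbedding (Θ ∘ₗ j.limitInclusion)) ∧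
    -- `C(M_ν(S), j^{(ν)}) = M_ν(C(S, j))`
    (∀ (ν : ℕ) (a : ∀ n, Matrix (Fin ν) (Fin ν) (S n)), j.IsMatConvergent a ↔
      ∃ c : Matrix (Fin ν) (Fin ν) j.convNets.Elem,
        ∀ n, (c.map j.convNets.incl).map (SoftLimits.Nets.eval n) = a n) ∧
    -- positive elements of the limit are exactly the limits of positive `j`-convergent nets
    (∀ (ν : ℕ) (x : Matrix (Fin ν) (Fin ν) j.Limit), x ∈ SoftLimits.MatrixOrder.cone ν ↔
      ∃ c : Matrix (Fin ν) (Fin ν) j.convNets.Elem,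
        (∀ n, (c.map j.convNets.incl).map (SoftLimits.Nets.eval n) ∈
          SoftLimits.MatrixOrder.cone ν) ∧
        c.map j.nullConvNets.quotMap = x) := by
  refine ⟨j.isNetSystem_convNets.isOperatorSystem_quotient,
    SoftLimits.isNetSystem_nets.isOperatorSystem_quotient,
    j.isNetSystem_convNets.quotientsCompletelyIsometric,
    SoftLimits.isNetSystem_nets.quotientsCompletelyIsometric,
    j.isNetSystem_convNets.isCompletelyBiproximinalKernel,
    SoftLimits.isNetSystem_nets.isCompletelyBiproximinalKernel,
    j.isCompleteOrderEmbedding_limitInclusion, j.range_limitInclusion,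
    fun A _ ι hι => ⟨SoftLimits.quotientRep hι,
      fun a => ⟨SoftLimits.memℓp_rep hι a, rfl⟩,
      SoftLimits.isCompleteOrderEmbedding_quotientRep hι,
      (SoftLimits.isCompleteOrderEmbedding_quotientRep hι).comp
        j.isCompleteOrderEmbedding_limitInclusion⟩,
    fun ν a => j.isMatConvergent_iff_exists a, fun ν x => j.mem_cone_limit_iff x⟩
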